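/- For a positive integer $n$, let $\mathbb{M}_n$ denote the (finite) set of all matroids with ground set $\{1,\ldots,n\}$. The girth of a matroid $M$ is the smallest cardinality of a circuit of $M$ (and $\infty$ if $M$ has no circuits). For every real number $c<1/2$, asymptotically almost all matroids on $n$ elements have girth at least $c\log_2 n$; that is, $$\lim_{n\to\infty}\frac{|\{M\in\mathbb{M}_n : \text{the girth of } M \text{ is at least } c\log_2 n\}|}{|\mathbb{M}_n|}=1.$$ -/

import Mathlib

open Filter Topology

/-- The girth of a matroid: the smallest cardinality of a circuit
(`⊤` if the matroid has no circuits). -/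
noncomputable def Matroid.girth {α : Type*} (M : Matroid α) : ℕ∞ :=
  ⨅ C : Set α, ⨅ _ : M.IsCircuit C, C.encard

/-- The (labelled) matroids with ground set exactly the `n`-element set `Fin n`. -/
def matroidsOn (n : ℕ) : Set (Matroid (Fin n)) := {M | M.E = Set.univ}

theorem matroidsOn_finite (n : ℕ) : (matroidsOn n).Finite := by
  refine Set.Finite.of_injOn (f := fun M : Matroid (Fin n) => {I | M.Indep I})
    (t := Set.univ) (fun _ _ => Set.mem_univ _) ?_ Set.finite_univ
  intro M hM N hN h
  have hM' : M.E = Set.univ := hM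
  have hN' : N.E = Set.univ := hN
  exact Matroid.ext_indep (hM'.trans hN'.symm) fun I _ => Set.ext_iff.mp h I

theorem matroidsOn_nonempty (n : ℕ) : (matroidsOn n).Nonempty :=
  ⟨Matroid.freeOn Set.univ, Matroid.freeOn_ground⟩

/-- `P` holds for asymptotically almost all matroids: the fraction of the matroids on the ground set
`Fin n` that have property `P` tends to `1` as `n → ∞`. -/
def AlmostAllMatroids (P : ∀ n : ℕ, Matroid (Fin n) → Prop) : Prop :=
  Tendsto (fun n : ℕ =>
    (({M | M ∈ matroidsOn n ∧ P n M} : Set (Matroid (Fin n))).ncard : ℝ) / (matroidsOn n).ncard)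
    atTop (𝓝 1)

set_option linter.unusedSectionVars false

namespace MatroidGirth

open Finset

variable {α : Type*} [DecidableEq α]

/-! ### Finite independence -/

/-! Fix a rank r, write N for n choose r, and call dependent r-sets nonbases. Every stable set of
the Johnson graph is the family of nonbases of a sparse paving matroid (`exists_sparse_paving`), so
there are at least as many rank-r matroids as stable sets. It thus suffices to describe a matroid M
with a short circuit C by a little extra data together with a stable set, in such a way that very
many stable sets serve for the same M.

The extra data is a code: a family of circuits and a family of hyperplanes of M, with C among the
circuits. It forces some r-sets to be dependent in every compatible matroid. An unforced nonbasis
has few nonbases around it, and if two unforced nonbases are adjacent, then dependence of one in a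
compatible matroid implies dependence of the other (`IsCode.not_ind_of_adj`). Hence the code and any
maximal stable set of unforced nonbases determine M. Greedy hitting sets give codes of size O(N log
n / n^(3/2)) (`exists_isCode`).

The circuit C supplies the freedom (`IsCode.exists_many`). Fix a in C and a maximal stable family Q
of unforced nonbases that contain all of C except a. If Q is large, exchanging a with another
element of C in an arbitrary subfamily of Q gives many stable sets. If Q is small, few supersets of
C are adjacent to it, so an arbitrary subfamily of a large stable family of supersets of C can be
added to the stable set; these are known to be dependent and serve as padding. Either way there are
2^θ choices, with θ about N / (n 2^|C|).

Counting pairs of a matroid and a stable set (`ncard_shortCircuit_mul_le`), the gain θ must beat the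
logarithm of the number of codes, about N log² n / n^(3/2) up to a negligible term. For |C| ≤ c log₂
n the gain is about N / n^(1+c), so c < 1/2 is what is needed. Loops are traded for parallel pairs
(`ncard_circuit_le`), and ranks whose binomial coefficient is small contain negligibly many matroids
(`eventually_two_pow_le_matroidsOn`). -/

/-- Independence of finite sets in a matroid. -/
def Ind (M : Matroid α) (X : Finset α) : Prop := M.Indep (X : Set α)

/-- A matroid on the whole type all of whose bases have `r` elements. -/
def HasRank (M : Matroid α) (r : ℕ) : Prop :=
  M.E = Set.univ ∧ ∃ B : Finset α, M.IsBase (B : Set α) ∧ B.card = r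

/-- Finite circuits, in terms of `Ind`. -/
def IsCirc (M : Matroid α) (C : Finset α) : Prop := ¬ Ind M C ∧ ∀ e ∈ C, Ind M (C.erase e)

lemma Ind.mono {M : Matroid α} {X Y : Finset α} (hY : Ind M Y) (h : X ⊆ Y) : Ind M X :=
  Matroid.Indep.subset hY (by exact_mod_cast h)

lemma Ind.augment {M : Matroid α} {A B : Finset α} (hA : Ind M A) (hB : Ind M B)
    (h : A.card < B.card) : ∃ x ∈ B, x ∉ A ∧ Ind M (insert x A) := by
  have := Matroid.Indep.augment hA hB (by simpa [Set.encard_coe_eq_coe_finsetCard] using h)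
  obtain ⟨x, hx, hi⟩ := this
  refine ⟨x, by simpa using hx.1, by simpa using hx.2, ?_⟩
  simpa [Ind] using hi

lemma Ind.exists_superset {M : Matroid α} {A B : Finset α} (hA : Ind M A) (hB : Ind M B)
    (h : A.card ≤ B.card) : ∃ A' : Finset α, A ⊆ A' ∧ A' ⊆ A ∪ B ∧ Ind M A' ∧ A'.card = B.card := by
  obtain ⟨d, hd⟩ := Nat.exists_eq_add_of_le h
  induction d generalizing A with
  | zero => exact ⟨A, Subset.rfl, subset_union_left, hA, by omega⟩
  | succ d ih =>
    obtain ⟨x, hxB, hxA, hi⟩ := hA.augment hB (by omega)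
    have hc : (insert x A).card = A.card + 1 := card_insert_of_notMem hxA
    obtain ⟨A', h1, h2, h3, h4⟩ := ih hi (by omega) (by omega)
    refine ⟨A', (subset_insert _ _).trans h1, h2.trans ?_, h3, h4⟩
    intro y hy
    simp only [mem_union, mem_insert] at hy ⊢
    rcases hy with (rfl | hy) | hy
    · exact Or.inr hxB
    · exact Or.inl hy
    · exact Or.inr hy

lemma IsCirc.not_subset {M : Matroid α} {C X : Finset α} (hC : IsCirc M C) (hX : Ind M X) :
    ¬ C ⊆ X := fun h => hC.1 (hX.mono h)

/-- Extend C - p by elements of X to an independent set of size |X|. It cannot contain p, since it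
would then contain C, so it lies in X + w - p and equals it by size. -/
lemma IsCirc.ind_exchange {M : Matroid α} {C X : Finset α} {w p : α} (hC : IsCirc M C)
    (hX : Ind M X) (hw : w ∉ X) (hCX : C ⊆ insert w X) (hp : p ∈ C) :
    Ind M ((insert w X).erase p) := by
  have hCp := hC.2 p hp
  have hle : (C.erase p).card ≤ X.card := by
    have := card_le_card hCX
    rw [card_insert_of_notMem hw] at this
    rw [card_erase_of_mem hp]; omega
  obtain ⟨A, h1, h2, h3, h4⟩ := hCp.exists_superset hX hle
  have hpA : p ∉ A := by
    intro hpA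
    refine hC.not_subset h3 fun x hx => ?_
    by_cases hxp : x = p
    · exact hxp ▸ hpA
    · exact h1 (mem_erase.2 ⟨hxp, hx⟩)
  have hsub : A ⊆ (insert w X).erase p := by
    intro x hx
    refine mem_erase.2 ⟨fun h => hpA (h ▸ hx), ?_⟩
    rcases mem_union.1 (h2 hx) with h | h
    · exact hCX (mem_of_mem_erase h)
    · exact mem_insert_of_mem h
  have : A = (insert w X).erase p := by
    refine eq_of_subset_of_card_le hsub ?_
    rw [card_erase_of_mem (hCX hp), card_insert_of_notMem hw]; omega
  exact this ▸ h3

lemma exists_isCirc_subset {M : Matroid α} {X : Finset α} (hX : ¬ Ind M X) :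
    ∃ C ⊆ X, IsCirc M C := by
  induction X using Finset.strongInduction with
  | H X ih =>
    by_cases h : ∀ e ∈ X, Ind M (X.erase e)
    · exact ⟨X, Subset.rfl, hX, h⟩
    · push Not at h
      obtain ⟨e, he, hd⟩ := h
      obtain ⟨C, hC, hC'⟩ := ih _ (erase_ssubset he) hd
      exact ⟨C, hC.trans (erase_subset _ _), hC'⟩

lemma IsCirc.eq_of_subset {M : Matroid α} {C C' : Finset α} (hC : IsCirc M C) (hC' : IsCirc M C')
    (h : C ⊆ C') : C = C' := by
  by_contra hne
  obtain ⟨e, he, he'⟩ := exists_of_ssubset (h.ssubset_of_ne hne)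
  exact hC.not_subset (hC'.2 e he) fun x hx =>
    mem_erase.2 ⟨fun hxe => he' (hxe ▸ hx), h hx⟩

/-- If the union without x were independent, an exchange along C would bring x in and remove some p
in C but not in C', leaving an independent set that contains C'. -/
lemma IsCirc.elimination {M : Matroid α} {C C' : Finset α} (hC : IsCirc M C) (hC' : IsCirc M C')
    (h : C ≠ C') (x : α) : ¬ Ind M ((C ∪ C').erase x) := by
  intro hD
  have hx : x ∈ C := by
    by_contra hx
    exact hC.not_subset hD fun y hy =>
      mem_erase.2 ⟨fun e => hx (e ▸ hy), mem_union_left _ hy⟩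
  obtain ⟨p, hp, hp'⟩ : ∃ p ∈ C, p ∉ C' := by
    by_contra hcon
    push Not at hcon
    exact h (hC.eq_of_subset hC' hcon)
  have hU : insert x ((C ∪ C').erase x) = C ∪ C' := insert_erase (mem_union_left _ hx)
  have := hC.ind_exchange hD (notMem_erase _ _) (by rw [hU]; exact subset_union_left) hp
  rw [hU] at this
  exact hC'.not_subset this fun y hy =>
    mem_erase.2 ⟨fun e => hp' (e ▸ hy), mem_union_right _ hy⟩

/-- The properties of the closure of an independent set of size `r - 1` in a matroid of rank `r`
that are needed to recognise dependent sets. -/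
structure IsHyp (M : Matroid α) (r : ℕ) (H : Finset α) : Prop where
  not_ind : ∀ I ⊆ H, I.card = r → ¬ Ind M I
  insert_ind : ∀ V ⊆ H, Ind M V → V.card + 1 = r → ∀ y, y ∉ H → Ind M (insert y V)

open Classical in
-- The witness is the closure of I: by augmentation from I it contains no independent r-set, and any
-- independent (r - 1)-subset V of it plays the same role as I.
lemma exists_isHyp [Fintype α] {M : Matroid α} {r : ℕ} {I : Finset α} (hI : Ind M I)
    (hr : I.card + 1 = r) : ∃ H, IsHyp M r H ∧ I ⊆ H ∧ ∀ e, ¬ Ind M (insert e I) → e ∈ H := by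
  set H : Finset α := univ.filter fun e => e ∈ I ∨ ¬ Ind M (insert e I) with hH
  have hna : ∀ J ⊆ H, J.card = r → ¬ Ind M J := by
    intro J hJ hc hind
    obtain ⟨x, hx, hxI, hi⟩ := hI.augment hind (by omega)
    have := hJ hx
    simp only [hH, mem_filter, mem_univ, true_and] at this
    tauto
  have hIH : I ⊆ H := fun x hx => by simp [hH, hx]
  refine ⟨H, ⟨hna, fun V hV hVi hVc y hy => ?_⟩, hIH, fun e he => by simp [hH, he]⟩
  simp only [hH, mem_filter, mem_univ, true_and, not_or, not_not] at hy
  obtain ⟨x, hx, hxV, hi⟩ := hVi.augment hy.2 (by rw [card_insert_of_notMem hy.1]; omega)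
  rcases mem_insert.1 hx with rfl | hxI
  · exact hi
  · exact absurd hi (hna _ (insert_subset (hIH hxI) hV)
      (by rw [card_insert_of_notMem hxV]; omega))

/-! ### The Johnson graph -/

/-- Adjacency in the Johnson graph: `X` arises from `Y` by exchanging one element. -/
def Adj (Y X : Finset α) : Prop := ∃ p ∈ Y, ∃ w, w ∉ Y ∧ X = insert w (Y.erase p)

lemma Adj.symm {Y X : Finset α} (h : Adj Y X) : Adj X Y := by
  obtain ⟨p, hp, w, hw, rfl⟩ := h
  have hpw : p ≠ w := fun h => hw (h ▸ hp)
  refine ⟨w, mem_insert_self _ _, p, by simp [hpw], ?_⟩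
  rw [erase_insert (by simp [hw]), insert_erase hp]

lemma Adj.card_eq {Y X : Finset α} (h : Adj Y X) : X.card = Y.card := by
  obtain ⟨p, hp, w, hw, rfl⟩ := h
  rw [card_insert_of_notMem (by simp [hw]), card_erase_of_mem hp]
  have := card_pos.2 ⟨p, hp⟩
  omega

lemma Adj.ne {Y X : Finset α} (h : Adj Y X) : Y ≠ X := by
  obtain ⟨p, hp, w, hw, rfl⟩ := h
  exact fun h => hw (h ▸ mem_insert_self _ _)

open Classical in
-- Distinct pairs (p, w) give distinct neighbours. This turns structure around Y into a lower bound
-- on its degree in B, to be played against the upper bounds that a code provides.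
lemma card_mul_card_le_neighbours {Y P Q : Finset α} {B : Finset (Finset α)} (hP : P ⊆ Y)
    (hQ : ∀ w ∈ Q, w ∉ Y) (h : ∀ p ∈ P, ∀ w ∈ Q, insert w (Y.erase p) ∈ B) :
    P.card * Q.card ≤ (B.filter (Adj Y)).card := by
  rw [← card_product]
  refine card_le_card_of_injOn (fun x => insert x.2 (Y.erase x.1)) ?_ ?_
  · intro x hx
    have hx' := mem_product.1 hx
    exact mem_coe.2 (mem_filter.2 ⟨h _ hx'.1 _ hx'.2, x.1, hP hx'.1, x.2, hQ _ hx'.2, rfl⟩)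
  · rintro ⟨p, w⟩ hx ⟨p', w'⟩ hx' heq
    simp only [coe_product, Set.mem_prod, mem_coe] at hx hx' heq
    have h1 := hQ _ hx.2
    have h2 := hQ _ hx'.2
    have hp := hP hx.1
    have hp' := hP hx'.1
    have hw : w = w' := by
      have : w ∈ insert w' (Y.erase p') := heq ▸ mem_insert_self _ _
      rcases mem_insert.1 this with h | h
      · exact h
      · exact absurd (mem_of_mem_erase h) h1
    have hpp : p = p' := by
      by_contra hne
      have : p ∈ insert w' (Y.erase p') := mem_insert_of_mem (mem_erase.2 ⟨hne, hp⟩)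
      rw [← heq] at this
      rcases mem_insert.1 this with h | h
      · exact h1 (h ▸ hp)
      · exact (mem_erase.1 h).1 rfl
    rw [hw, hpp]

/-! ### Dependent sets of full size -/

section Codes

variable [Fintype α]

open Classical in
/-- The dependent `r`-sets. -/
noncomputable def nonbases (M : Matroid α) (r : ℕ) : Finset (Finset α) :=
  (univ.powersetCard r).filter fun X => ¬ Ind M X

open Classical in
/-- The dependent `r`-sets containing an independent set of size `r - 1`. -/
noncomputable def corankOne (M : Matroid α) (r : ℕ) : Finset (Finset α) :=
  (nonbases M r).filter fun X => ∃ x ∈ X, Ind M (X.erase x)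

open Classical in
/-- The dependent `r`-sets all of whose proper subsets are dependent after removing one element. -/
noncomputable def corankTwo (M : Matroid α) (r : ℕ) : Finset (Finset α) :=
  (nonbases M r).filter fun X => ∀ x ∈ X, ¬ Ind M (X.erase x)

open Classical in
/-- The members of `corankOne` with fewer than `D` neighbours in `corankOne`. -/
noncomputable def sparsePart (M : Matroid α) (r D : ℕ) : Finset (Finset α) :=
  (corankOne M r).filter fun X => ((corankOne M r).filter (Adj X)).card < D

lemma mem_nonbases {M : Matroid α} {r : ℕ} {X : Finset α} :
    X ∈ nonbases M r ↔ X.card = r ∧ ¬ Ind M X := by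
  simp [nonbases, mem_powersetCard]

/-! ### Dependence forced by circuits and hyperplanes -/

/-- Compatibility of a matroid with a family of circuits and a family of hyperplanes. -/
structure Compat (M : Matroid α) (r : ℕ) (Cs Hs : Finset (Finset α)) : Prop where
  circ : ∀ C ∈ Cs, IsCirc M C
  hyp : ∀ H ∈ Hs, IsHyp M r H

/-- `Y` is dependent in every matroid that is compatible with the given families. -/
def Forced (r : ℕ) (Cs Hs : Finset (Finset α)) (Y : Finset α) : Prop :=
  ∀ M : Matroid α, Compat M r Cs Hs → ¬ Ind M Y

lemma forced_of_circ_subset {r : ℕ} {Cs Hs : Finset (Finset α)} {C Y : Finset α} (hC : C ∈ Cs)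
    (h : C ⊆ Y) : Forced r Cs Hs Y := fun _ hM hi => (hM.circ C hC).not_subset hi h

lemma forced_of_subset_hyp {r : ℕ} {Cs Hs : Finset (Finset α)} {H Y : Finset α} (hH : H ∈ Hs)
    (h : Y ⊆ H) (hY : Y.card = r) : Forced r Cs Hs Y := fun _ hM => (hM.hyp H hH).not_ind Y h hY

/-- The circuit in `X` and the hyperplane spanned by `X` belong to the given families. -/
def Pinned (M : Matroid α) (r : ℕ) (Cs Hs : Finset (Finset α)) (X : Finset α) : Prop :=
  X ∈ nonbases M r ∧ ∃ C ∈ Cs, ∃ H ∈ Hs, C ⊆ X ∧ X ⊆ H ∧ ∀ p ∈ C, Ind M (X.erase p)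

/-- A nonbasis X with an independent X - x spans a hyperplane, the closure of X - x. Removing any
element of a circuit inside X leaves an independent set, by exchange. -/
lemma exists_circuit_hyperplane {M : Matroid α} {r : ℕ} {X : Finset α} (hX : X ∈ corankOne M r) :
    ∃ C H, IsCirc M C ∧ IsHyp M r H ∧ C ⊆ X ∧ X ⊆ H ∧ ∀ p ∈ C, Ind M (X.erase p) := by
  simp only [corankOne, mem_filter, mem_nonbases] at hX
  obtain ⟨⟨hc, hd⟩, x, hx, hi⟩ := hX
  obtain ⟨C, hCX, hC⟩ := exists_isCirc_subset hd
  have hcard : (X.erase x).card + 1 = r := by rw [card_erase_add_one hx, hc]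
  obtain ⟨H, hH, hXH, hcl⟩ := exists_isHyp hi hcard
  refine ⟨C, H, hC, hH, hCX, ?_, fun p hp => ?_⟩
  · have hxH : x ∈ H := hcl x (by rwa [insert_erase hx])
    rw [← insert_erase hx]
    exact insert_subset hxH hXH
  · have := hC.ind_exchange hi (notMem_erase _ _) (by rwa [insert_erase hx]) hp
    rwa [insert_erase hx] at this

/-- Let Y = X - p + w. If p is not in C, the circuit survives; if p is in C, then X - p is
independent in H, and a w outside H would make Y independent. -/
lemma circuit_subset_or_subset_hyperplane {M : Matroid α} {r : ℕ} {C H X Y : Finset α}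
    (hH : IsHyp M r H) (hX : X.card = r) (hXH : X ⊆ H) (hCX : C ⊆ X)
    (hp : ∀ p ∈ C, Ind M (X.erase p)) (hXY : Adj X Y) (hY : ¬ Ind M Y) : C ⊆ Y ∨ Y ⊆ H := by
  obtain ⟨p, hpX, w, hw, rfl⟩ := hXY
  by_cases hpC : p ∈ C
  · right
    by_cases hwH : w ∈ H
    · exact insert_subset hwH ((erase_subset _ _).trans hXH)
    · exact absurd (hH.insert_ind _ ((erase_subset p X).trans hXH) (hp p hpC)
        (by rw [card_erase_add_one hpX, hX]) w hwH) hY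
  · left
    intro x hx
    exact mem_insert_of_mem (mem_erase.2 ⟨fun h => hpC (h ▸ hx), hCX hx⟩)

lemma Pinned.circuit_or_hyperplane {M : Matroid α} {r : ℕ} {Cs Hs : Finset (Finset α)}
    {X Y : Finset α} (hX : Pinned M r Cs Hs X) (hM : Compat M r Cs Hs) (hXY : Adj X Y)
    (hY : ¬ Ind M Y) : (∃ C ∈ Cs, C ⊆ Y) ∨ ∃ H ∈ Hs, Y ⊆ H := by
  obtain ⟨hX, C, hC, H, hH, hCX, hXH, hp⟩ := hX
  rcases circuit_subset_or_subset_hyperplane (hM.hyp H hH) (mem_nonbases.1 hX).1 hXH hCX hp hXY hY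
    with h | h
  · exact Or.inl ⟨C, hC, h⟩
  · exact Or.inr ⟨H, hH, h⟩

/-- One pinned set certifies all its dependent neighbours at once, so a code only has to hit
neighbourhoods. -/
lemma Pinned.forced {M : Matroid α} {r : ℕ} {Cs Hs : Finset (Finset α)}
    {X Y : Finset α} (hX : Pinned M r Cs Hs X) (hM : Compat M r Cs Hs) (hXY : Adj X Y)
    (hY : ¬ Ind M Y) : Forced r Cs Hs Y := by
  rcases hX.circuit_or_hyperplane hM hXY hY with ⟨C, hC, h⟩ | ⟨H, hH, h⟩
  · exact forced_of_circ_subset hC h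
  · exact forced_of_subset_hyp hH h (hXY.card_eq.trans (mem_nonbases.1 hX.1).1)

lemma exists_two_circuits {M : Matroid α} {r : ℕ} {X : Finset α} (hX : X ∈ corankTwo M r) :
    ∃ C C', IsCirc M C ∧ IsCirc M C' ∧ C ≠ C' ∧ C ⊆ X ∧ C' ⊆ X := by
  simp only [corankTwo, mem_filter, mem_nonbases] at hX
  obtain ⟨⟨-, hd⟩, hx⟩ := hX
  obtain ⟨C, hCX, hC⟩ := exists_isCirc_subset hd
  have hne : C.Nonempty := by
    rw [nonempty_iff_ne_empty]
    rintro rfl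
    exact hC.1 (by simp [Ind])
  obtain ⟨e, he⟩ := hne
  obtain ⟨C', hCX', hC'⟩ := exists_isCirc_subset (hx e (hCX he))
  refine ⟨C, C', hC, hC', ?_, hCX, hCX'.trans (erase_subset _ _)⟩
  rintro rfl
  exact (mem_erase.1 (hCX' he)).1 rfl

/-- Circuit elimination leaves a dependent set after the removal of any one element, so all
neighbours of X are dependent. -/
lemma forced_of_two_circuits {r : ℕ} {Cs Hs : Finset (Finset α)} {C C' X Y : Finset α}
    (hC : C ∈ Cs) (hC' : C' ∈ Cs) (hne : C ≠ C') (h : C ⊆ X) (h' : C' ⊆ X) (hXY : Adj X Y) :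
    Forced r Cs Hs Y := by
  intro M hM hi
  obtain ⟨p, hpX, w, hw, rfl⟩ := hXY
  refine (hM.circ C hC).elimination (hM.circ C' hC') hne p (hi.mono ?_)
  exact (erase_subset_erase _ (union_subset h h')).trans (subset_insert _ _)

open Classical in
/-- Families of circuits and hyperplanes forcing all dependent `r`-sets with many neighbours of a
given kind. -/
structure IsCode (M : Matroid α) (r D d : ℕ) (Cs Hs : Finset (Finset α)) : Prop
    extends Compat M r Cs Hs where
  forced_of_corankTwo : ∀ Y ∈ nonbases M r, D ≤ ((corankTwo M r).filter (Adj Y)).card → Forced r Cs Hs Y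
  pinned_of_corankOne : ∀ Y ∈ nonbases M r, D ≤ ((corankOne M r).filter (Adj Y)).card →
    ∃ X, Adj X Y ∧ Pinned M r Cs Hs X
  pinned_of_sparse : ∀ Y ∈ nonbases M r, d ≤ ((sparsePart M r D).filter (Adj Y)).card →
    ∃ X, Adj X Y ∧ Pinned M r Cs Hs X

end Codes

end MatroidGirth

/-! ### Adjacent unforced nonbases determine each other -/

namespace MatroidGirth

open Finset

variable {α : Type*} [DecidableEq α] [Fintype α]

open Classical in
lemma card_filter_nonbases_le (M : Matroid α) (r : ℕ) (Y : Finset α) :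
    ((nonbases M r).filter (Adj Y)).card ≤
      ((corankOne M r).filter (Adj Y)).card + ((corankTwo M r).filter (Adj Y)).card := by
  refine (card_le_card ?_).trans (card_union_le _ _)
  intro X hX
  simp only [corankOne, corankTwo, mem_union, mem_filter] at hX ⊢
  by_cases h : ∃ x ∈ X, Ind M (X.erase x)
  · exact Or.inl ⟨⟨hX.1, h⟩, hX.2⟩
  · push Not at h
    exact Or.inr ⟨⟨hX.1, h⟩, hX.2⟩

open Classical in
lemma IsCode.card_neighbours_lt {M : Matroid α} {r D d : ℕ} {Cs Hs : Finset (Finset α)}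
    (hM : IsCode M r D d Cs Hs) {Y : Finset α} (hY : Y ∈ nonbases M r)
    (hYf : ¬ Forced r Cs Hs Y) : ((nonbases M r).filter (Adj Y)).card < 2 * D := by
  have h1 : ((corankOne M r).filter (Adj Y)).card < D := by
    by_contra h
    obtain ⟨X, hX, hp⟩ := hM.pinned_of_corankOne Y hY (not_lt.1 h)
    exact hYf (hp.forced hM.toCompat hX (mem_nonbases.1 hY).2)
  have h2 : ((corankTwo M r).filter (Adj Y)).card < D := by
    by_contra h
    exact hYf (hM.forced_of_corankTwo Y hY (not_lt.1 h))
  have := card_filter_nonbases_le M r Y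
  omega

open Classical in
lemma IsCode.card_sparse_lt {M : Matroid α} {r D d : ℕ} {Cs Hs : Finset (Finset α)}
    (hM : IsCode M r D d Cs Hs) {Y : Finset α} (hY : Y ∈ nonbases M r)
    (hYf : ¬ Forced r Cs Hs Y) : ((sparsePart M r D).filter (Adj Y)).card < d := by
  by_contra h
  obtain ⟨X, hX, hp⟩ := hM.pinned_of_sparse Y hY (not_lt.1 h)
  exact hYf (hp.forced hM.toCompat hX (mem_nonbases.1 hY).2)

lemma card_exchange {Y : Finset α} {p w : α} (hp : p ∈ Y) (hw : w ∉ Y) :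
    (insert w (Y.erase p)).card = Y.card :=
  Adj.card_eq ⟨p, hp, w, hw, rfl⟩

/-- Otherwise all r(n - r) neighbours of Y would be nonbases, more than an unforced nonbasis can
have. -/
lemma IsCode.mem_corankOne {M : Matroid α} {r D d : ℕ} {Cs Hs : Finset (Finset α)}
    (hM : IsCode M r D d Cs Hs) (hD : 2 * D ≤ r * (Fintype.card α - r)) {Y : Finset α}
    (hY : Y ∈ nonbases M r) (hYf : ¬ Forced r Cs Hs Y) : Y ∈ corankOne M r := by
  classical
  by_contra hcon
  simp only [corankOne, mem_filter, not_and, not_exists] at hcon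
  have hcon := hcon hY
  have hcard := (mem_nonbases.1 hY).1
  have := card_mul_card_le_neighbours (Y := Y) (P := Y) (Q := Yᶜ) (B := nonbases M r) Subset.rfl
    (fun w hw => by simpa using hw) fun p hp w hw => by
      rw [mem_nonbases]
      have hw' : w ∉ Y := by simpa using hw
      exact ⟨(card_exchange hp hw').trans hcard,
        fun hi => hcon p hp (hi.mono (subset_insert _ _))⟩
  rw [card_compl, hcard] at this
  have := hM.card_neighbours_lt hY hYf
  omega

lemma IsCode.exists_pinned {M : Matroid α} {r D d : ℕ} {Cs Hs : Finset (Finset α)}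
    (hM : IsCode M r D d Cs Hs) {Z : Finset α} (hZ : Z ∈ corankOne M r)
    (hZs : Z ∉ sparsePart M r D) : ∃ X, Adj X Z ∧ Pinned M r Cs Hs X := by
  classical
  have hZn : Z ∈ nonbases M r := (mem_filter.1 hZ).1
  refine hM.pinned_of_corankOne Z hZn ?_
  by_contra h
  exact hZs (mem_filter.2 ⟨hZ, not_le.1 h⟩)

/-- An unforced dependent `r`-set that is adjacent to another one inside the hyperplane it spans is
dependent in every compatible matroid in which the other one is. -/
lemma IsCode.not_ind_of_mem_hyperplane {M M' : Matroid α} {r D d : ℕ} {Cs Hs : Finset (Finset α)}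
    (hM : IsCode M r D d Cs Hs) (hM' : Compat M' r Cs Hs) {Y C H : Finset α} {p w : α}
    (hY : Y ∈ nonbases M r) (hYf : ¬ Forced r Cs Hs Y) (hp : p ∈ Y) (hw : w ∉ Y)
    (hH : IsHyp M r H) (hYH : Y ⊆ H) (hCY : C ⊆ Y) (hC : ∀ p ∈ C, Ind M (Y.erase p))
    (hwH : w ∈ H) (hd : d ≤ C.card) (hYf' : ¬ Forced r Cs Hs (insert w (Y.erase p)))
    (hd' : ¬ Ind M' (insert w (Y.erase p))) : ¬ Ind M' Y := by
  classical
  obtain ⟨hcard, hdep⟩ := mem_nonbases.1 hY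
  -- The sets Y - z + w with z in C are at least `d` neighbours of Y, and fewer than `d` neighbours
  -- of an unforced nonbasis are sparse.
  obtain ⟨z, hz, hzs⟩ : ∃ z ∈ C, insert w (Y.erase z) ∉ sparsePart M r D := by
    by_contra! hcon
    have := card_mul_card_le_neighbours (Y := Y) (P := C) (Q := {w}) hCY (by simpa using hw)
      (B := sparsePart M r D) fun q hq v hv => by
        rw [mem_singleton.1 hv]; exact hcon q hq
    have := hM.card_sparse_lt hY hYf
    simp at *
    omega
  have hzY := hCY hz
  have hwz : w ∉ Y.erase z := fun h => hw (mem_of_mem_erase h)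
  have hZH : insert w (Y.erase z) ⊆ H := insert_subset hwH ((erase_subset _ _).trans hYH)
  have hZc := (card_exchange hzY hw).trans hcard
  have hZd : ¬ Ind M (insert w (Y.erase z)) := hH.not_ind _ hZH hZc
  have hZ1 : insert w (Y.erase z) ∈ corankOne M r :=
    mem_filter.2 ⟨mem_nonbases.2 ⟨hZc, hZd⟩, w, mem_insert_self _ _,
      by rw [erase_insert hwz]; exact hC z hz⟩
  obtain ⟨X, hXZ, hX⟩ := hM.exists_pinned hZ1 hzs
  rcases hX.circuit_or_hyperplane hM.toCompat hXZ hZd with ⟨C', hC', hsub⟩ | ⟨H', hH', hsub⟩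
  -- A code circuit C' lies in Y + w. It contains p, as Y - p + w is unforced, so if Y were
  -- independent in `M'`, exchange along C' would make Y - p + w independent too.
  · have hpC : p ∈ C' := by
      by_contra hpC
      refine hYf' (forced_of_circ_subset hC' fun x hx => ?_)
      rcases mem_insert.1 (hsub hx) with h | h
      · exact h ▸ mem_insert_self _ _
      · exact mem_insert_of_mem (mem_erase.2 ⟨fun e => hpC (e ▸ hx), mem_of_mem_erase h⟩)
    intro hi
    have := (hM'.circ C' hC').ind_exchange hi hw
      (hsub.trans (insert_subset_insert _ (erase_subset _ _))) hpC
    rw [erase_insert_of_ne (fun h => hw (by rw [h]; exact hp))] at this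
    exact hd' this
  -- A code hyperplane H' contains the independent set Y - z. As Y is dependent, it contains z as
  -- well and forces Y.
  · exfalso
    refine hYf (forced_of_subset_hyp hH' ?_ hcard)
    have hsub' : Y.erase z ⊆ H' := (subset_insert _ _).trans hsub
    have hzH : z ∈ H' := by
      by_contra hzH
      refine hdep ?_
      have := (hM.hyp H' hH').insert_ind _ hsub' (hC z hz)
        (by rw [card_erase_add_one hzY, hcard]) z hzH
      rwa [insert_erase hzY] at this
    rw [← insert_erase hzY]
    exact insert_subset hzH hsub'

/-- An unforced dependent `r`-set that is adjacent to another one containing its circuit is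
dependent in every compatible matroid in which the other one is. -/
lemma IsCode.not_ind_of_notMem_hyperplane {M M' : Matroid α} {r D d : ℕ}
    {Cs Hs : Finset (Finset α)}
    (hM : IsCode M r D d Cs Hs) (hM' : Compat M' r Cs Hs) {Y C H : Finset α} {p w : α}
    (hY : Y ∈ nonbases M r) (hYf : ¬ Forced r Cs Hs Y) (hp : p ∈ Y) (hw : w ∉ Y)
    (hH : IsHyp M r H) (hYH : Y ⊆ H) (hCc : IsCirc M C) (hCY : C ⊆ Y)
    (hC : ∀ p ∈ C, Ind M (Y.erase p))
    (hpC : p ∉ C) (hd : d ≤ (Hᶜ).card) (hYf' : ¬ Forced r Cs Hs (insert w (Y.erase p)))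
    (hd' : ¬ Ind M' (insert w (Y.erase p))) : ¬ Ind M' Y := by
  classical
  obtain ⟨hcard, hdep⟩ := mem_nonbases.1 hY
  -- Dual to the choice inside the circuit: now z varies over the complement of H while p is fixed.
  obtain ⟨z, hz, hzs⟩ : ∃ z, z ∉ H ∧ insert z (Y.erase p) ∉ sparsePart M r D := by
    by_contra! hcon
    have := card_mul_card_le_neighbours (Y := Y) (P := {p}) (Q := Hᶜ) (by simpa using hp)
      (fun w hw h => by simp at hw; exact hw (hYH h))
      (B := sparsePart M r D) fun q hq v hv => by
        rw [mem_singleton.1 hq]; exact hcon v (by simpa using hv)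
    have := hM.card_sparse_lt hY hYf
    simp only [card_singleton, one_mul] at *
    omega
  have hzY : z ∉ Y := fun h => hz (hYH h)
  have hCV : C ⊆ Y.erase p := fun x hx => mem_erase.2 ⟨fun e => hpC (e ▸ hx), hCY hx⟩
  have hzp : z ∉ Y.erase p := fun h => hzY (mem_of_mem_erase h)
  have hZc := (card_exchange hp hzY).trans hcard
  have hZd : ¬ Ind M (insert z (Y.erase p)) := fun hi =>
    hCc.not_subset hi (hCV.trans (subset_insert _ _))
  have hZi : ∀ q ∈ C, Ind M ((insert z (Y.erase p)).erase q) := by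
    intro q hq
    have hqz : z ≠ q := fun e => hzY (e ▸ hCY hq)
    have h1 := hH.insert_ind _ ((erase_subset q Y).trans hYH) (hC q hq)
      (by rw [card_erase_add_one (hCY hq), hcard]) z hz
    refine h1.mono ?_
    rw [erase_insert_of_ne hqz, erase_right_comm]
    exact insert_subset_insert _ (erase_subset _ _)
  obtain ⟨q, hq⟩ : C.Nonempty := by
    rw [nonempty_iff_ne_empty]
    rintro rfl
    exact hCc.1 (by simp [Ind])
  have hZ1 : insert z (Y.erase p) ∈ corankOne M r :=
    mem_filter.2 ⟨mem_nonbases.2 ⟨hZc, hZd⟩, q, mem_insert_of_mem (hCV hq), hZi q hq⟩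
  obtain ⟨X, hXZ, hX⟩ := hM.exists_pinned hZ1 hzs
  rcases hX.circuit_or_hyperplane hM.toCompat hXZ hZd with ⟨C', hC', hsub⟩ | ⟨H', hH', hsub⟩
  -- C is the only circuit in Y - p + z, so the code circuit equals C and forces Y.
  · exfalso
    have hCC : C ⊆ C' := by
      intro q hq
      by_contra hqC
      exact (hM.circ C' hC').not_subset (hZi q hq)
        fun x hx => mem_erase.2 ⟨fun e => hqC (e ▸ hx), hsub hx⟩
    have := hCc.eq_of_subset (hM.circ C' hC') hCC
    subst this
    exact hYf (forced_of_circ_subset hC' hCY)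
  · have hV : Y.erase p ⊆ H' := (subset_insert _ _).trans hsub
    have hwH : w ∉ H' := fun h => hYf' (forced_of_subset_hyp hH' (insert_subset h hV)
      ((card_exchange hp hw).trans hcard))
    intro hi
    exact hd' ((hM'.hyp H' hH').insert_ind _ hV (hi.mono (erase_subset _ _))
      (by rw [card_erase_add_one hp, hcard]) w hwH)

/-- The numerical conditions on the parameters of a code. -/
structure CodeParams (n r D d : ℕ) : Prop where
  two_mul_le : 2 * D ≤ r * (n - r)
  add_le : ∀ a, a * (n - r) < 2 * D → a + d ≤ r
  add_le' : ∀ b, r * b < 2 * D → b + d ≤ n - r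

/-- Write Y' = Y - p + w and split according to whether w lies in the hyperplane H spanned by Y.
Since Y has fewer than 2D dependent neighbours, its circuit and the complement of H both have at
least d elements, which leaves enough choices for a non-sparse intermediate set. -/
lemma IsCode.not_ind_of_adj {M M' : Matroid α} {r D d : ℕ} {Cs Hs : Finset (Finset α)}
    (hp : CodeParams (Fintype.card α) r D d)
    (hM : IsCode M r D d Cs Hs) (hM' : Compat M' r Cs Hs) {Y Y' : Finset α}
    (hY : Y ∈ nonbases M r) (hYf : ¬ Forced r Cs Hs Y) (hY' : Y' ∈ nonbases M r)
    (hYf' : ¬ Forced r Cs Hs Y') (hadj : Adj Y Y') (hd' : ¬ Ind M' Y') : ¬ Ind M' Y := by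
  classical
  obtain ⟨C, H, hC, hH, hCY, hYH, hCi⟩ :=
    exists_circuit_hyperplane (hM.mem_corankOne hp.two_mul_le hY hYf)
  obtain ⟨hcard, hdep⟩ := mem_nonbases.1 hY
  obtain ⟨p, hpY, w, hw, rfl⟩ := hadj
  have hlt := hM.card_neighbours_lt hY hYf
  by_cases hwH : w ∈ H
  · refine hM.not_ind_of_mem_hyperplane hM' hY hYf hpY hw hH hYH hCY hCi hwH ?_ hYf' hd'
    -- Removing an element of Y outside C keeps C, so each such exchange gives a nonbasis; hence Y \
    -- C is small and C is large.
    have h1 := card_mul_card_le_neighbours (Y := Y) (P := Y \ C) (Q := Yᶜ) (B := nonbases M r)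
      sdiff_subset (fun w hw => by simpa using hw) fun q hq v hv => by
        have hv' : v ∉ Y := by simpa using hv
        have hq' := mem_sdiff.1 hq
        refine mem_nonbases.2 ⟨(card_exchange hq'.1 hv').trans hcard, fun hi =>
          hC.not_subset hi fun x hx => mem_insert_of_mem
            (mem_erase.2 ⟨fun e => hq'.2 (e ▸ hx), hCY hx⟩)⟩
    rw [card_compl, hcard] at h1
    have := hp.add_le _ (h1.trans_lt hlt)
    have := card_sdiff_add_card_eq_card hCY
    omega
  · have hpC : p ∉ C := by
      intro hpC
      exact (mem_nonbases.1 hY').2 (hH.insert_ind _ ((erase_subset p Y).trans hYH) (hCi p hpC)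
        (by rw [card_erase_add_one hpY, hcard]) w hwH)
    refine hM.not_ind_of_notMem_hyperplane hM' hY hYf hpY hw hH hYH hC hCY hCi hpC ?_ hYf' hd'
    -- Exchanges inside H stay dependent, so H \ Y is small and the complement of H is large.
    have h1 := card_mul_card_le_neighbours (Y := Y) (P := Y) (Q := H \ Y) (B := nonbases M r)
      Subset.rfl (fun w hw => (mem_sdiff.1 hw).2) fun q hq v hv => by
        have hv' := mem_sdiff.1 hv
        have hc := (card_exchange hq hv'.2).trans hcard
        exact mem_nonbases.2 ⟨hc, hH.not_ind _
          (insert_subset hv'.1 ((erase_subset _ _).trans hYH)) hc⟩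
    rw [hcard] at h1
    have := hp.add_le' _ (h1.trans_lt hlt)
    have h2 := card_sdiff_add_card_eq_card hYH
    rw [card_compl]
    omega

end MatroidGirth

namespace MatroidGirth

open Finset

variable {α : Type*} [DecidableEq α]

/-! ### Stable sets of the Johnson graph -/

/-- A family of sets no two of which are adjacent in the Johnson graph. -/
def Stable (S : Finset (Finset α)) : Prop := ∀ X ∈ S, ∀ Y ∈ S, ¬ Adj X Y

lemma Stable.exists_maximal {S A : Finset (Finset α)} (hS : Stable S) (hSA : S ⊆ A) :
    ∃ T, S ⊆ T ∧ T ⊆ A ∧ Stable T ∧ ∀ Y ∈ A, Y ∈ T ∨ ∃ Y' ∈ T, Adj Y Y' := by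
  classical
  obtain ⟨T, hT, hmax⟩ := exists_max_image (A.powerset.filter fun T => S ⊆ T ∧ Stable T) card
    ⟨S, by simp [hSA, hS]⟩
  simp only [mem_filter, mem_powerset] at hT hmax
  refine ⟨T, hT.2.1, hT.1, hT.2.2, fun Y hY => ?_⟩
  by_contra! hcon
  have hst : Stable (insert Y T) := by
    intro X hX Z hZ hXZ
    rcases mem_insert.1 hX with hX | hX <;> rcases mem_insert.1 hZ with hZ | hZ
    · exact hXZ.ne (hX.trans hZ.symm)
    · exact hcon.2 Z hZ (hX ▸ hXZ)
    · exact hcon.2 X hX (hZ ▸ hXZ.symm)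
    · exact hT.2.2 X hX Z hZ hXZ
  have := hmax (insert Y T) ⟨insert_subset hY hT.1, hT.2.1.trans (subset_insert _ _), hst⟩
  rw [card_insert_of_notMem hcon.1] at this
  omega

lemma Adj.image {Y X : Finset α} (h : Adj Y X) (e : Equiv.Perm α) :
    Adj (Y.image e) (X.image e) := by
  obtain ⟨p, hp, w, hw, rfl⟩ := h
  refine ⟨e p, mem_image_of_mem _ hp, e w, by simpa using hw, ?_⟩
  rw [image_insert, image_erase e.injective]

lemma image_swap_eq {X : Finset α} {a b : α} (ha : a ∉ X) (hb : b ∈ X) :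
    X.image (Equiv.swap a b) = insert a (X.erase b) := by
  have hX : X = insert b (X.erase b) := (insert_erase hb).symm
  have h : (X.erase b).image (Equiv.swap a b) = X.erase b := by
    conv_rhs => rw [← image_id (s := X.erase b)]
    refine image_congr fun x hx => ?_
    have hx' := mem_erase.1 (mem_coe.1 hx)
    exact Equiv.swap_apply_of_ne_of_ne (fun e => ha (e ▸ hx'.2)) hx'.1
  conv_lhs => rw [hX]
  rw [image_insert, h, Equiv.swap_apply_right]

/-- `c` is the only element of `C` that is missing in `X`. -/
def Misses (C : Finset α) (c : α) (X : Finset α) : Prop := c ∉ X ∧ C ⊆ insert c X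

lemma Misses.mem {C X : Finset α} {c e : α} (h : Misses C c X) (he : e ∈ C) (hne : e ≠ c) :
    e ∈ X := (mem_insert.1 (h.2 he)).resolve_left hne

lemma Misses.swap {C X : Finset α} {c e : α} (h : Misses C c X) (hne : e ≠ c) :
    Misses C e (insert c (X.erase e)) := by
  refine ⟨by simp [hne], fun x hx => ?_⟩
  rcases mem_insert.1 (h.2 hx) with rfl | hx'
  · simp
  · by_cases hxe : x = e <;> simp [hxe, hx']

lemma Misses.swap_swap {C X : Finset α} {c e : α} (h : Misses C c X) (he : e ∈ C) (hne : e ≠ c) :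
    insert e ((insert c (X.erase e)).erase c) = X := by
  rw [erase_insert (by simp [h.1]), insert_erase (h.mem he hne)]

lemma Misses.ind_swap {M : Matroid α} {C X : Finset α} {c e : α} (hC : IsCirc M C)
    (h : Misses C c X) (he : e ∈ C) (hne : e ≠ c) (hX : Ind M X) :
    Ind M (insert c (X.erase e)) := by
  have := hC.ind_exchange hX h.1 h.2 he
  rwa [erase_insert_of_ne hne.symm] at this

/-! ### Many stable sets determining one matroid -/

variable [Fintype α]

open Classical in
/-- The dependent `r`-sets that are not forced by the given families. -/
noncomputable def unforced (M : Matroid α) (r : ℕ) (Cs Hs : Finset (Finset α)) :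
    Finset (Finset α) := (nonbases M r).filter fun Y => ¬ Forced r Cs Hs Y

lemma mem_unforced {M : Matroid α} {r : ℕ} {Cs Hs : Finset (Finset α)} {Y : Finset α} :
    Y ∈ unforced M r Cs Hs ↔ Y ∈ nonbases M r ∧ ¬ Forced r Cs Hs Y := by
  simp [unforced]

/-- In every compatible matroid C is a circuit, so exchanging c and e along C preserves dependence
in both directions. -/
lemma Misses.swap_mem_unforced {M : Matroid α} {r : ℕ} {Cs Hs : Finset (Finset α)}
    {C X : Finset α} {c e : α} (hM : Compat M r Cs Hs) (hC : C ∈ Cs)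
    (h : Misses C c X) (hc : c ∈ C) (he : e ∈ C) (hne : e ≠ c) (hX : X ∈ unforced M r Cs Hs) :
    insert c (X.erase e) ∈ unforced M r Cs Hs := by
  rw [mem_unforced, mem_nonbases] at hX ⊢
  have key : ∀ M' : Matroid α, Compat M' r Cs Hs → ¬ Ind M' X →
      ¬ Ind M' (insert c (X.erase e)) := by
    intro M' hM' hi hi'
    have := (h.swap hne).ind_swap (hM'.circ C hC) hc hne.symm hi'
    rw [h.swap_swap he hne] at this
    exact hi this
  refine ⟨⟨(card_exchange (h.mem he hne) h.1).trans hX.1.1, key M hM hX.1.2⟩, fun hf => ?_⟩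
  exact hX.2 fun M' hM' hi => hf M' hM' (h.ind_swap (hM'.circ C hC) he hne hi)

lemma IsCode.not_ind_of_maximal {M M' : Matroid α} {r D d : ℕ} {Cs Hs : Finset (Finset α)}
    (hp : CodeParams (Fintype.card α) r D d)
    (hM : IsCode M r D d Cs Hs) (hM' : Compat M' r Cs Hs) {S A : Finset (Finset α)}
    (hA : A ⊆ unforced M r Cs Hs) (hSA : S ⊆ A)
    (hmax : ∀ Y ∈ A, Y ∈ S ∨ ∃ Y' ∈ S, Adj Y Y') (hS : S ⊆ nonbases M' r) {Y : Finset α}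
    (hY : Y ∈ A) : ¬ Ind M' Y := by
  rcases hmax Y hY with h | ⟨Y', hY', hadj⟩
  · exact (mem_nonbases.1 (hS h)).2
  · have h1 := mem_unforced.1 (hA hY)
    have h2 := mem_unforced.1 (hA (hSA hY'))
    exact hM.not_ind_of_adj hp hM' h1.1 h1.2 h2.1 h2.2 hadj (mem_nonbases.1 (hS hY')).2

/-- Together with the given families, `S` determines the dependent `r`-sets of `M`. -/
def Determines (M : Matroid α) (r : ℕ) (Cs Hs S : Finset (Finset α)) : Prop :=
  S ⊆ nonbases M r ∧ Stable S ∧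
    ∀ M', Compat M' r Cs Hs → S ⊆ nonbases M' r → nonbases M r ⊆ nonbases M' r

open Classical in
-- The transposition of a and b moves each member of Q to an adjacent unforced nonbasis. For each
-- subfamily f of Q, transpose exactly the members of f and extend to a maximal stable set of
-- unforced nonbases.
lemma IsCode.many_of_large {M : Matroid α} {r D d θ : ℕ} {Cs Hs : Finset (Finset α)}
    (hp : CodeParams (Fintype.card α) r D d) (hM : IsCode M r D d Cs Hs) {C : Finset α}
    (hC : C ∈ Cs) {a b : α} (ha : a ∈ C) (hb : b ∈ C) (hab : b ≠ a) {Q : Finset (Finset α)}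
    (hQ : Q ⊆ (unforced M r Cs Hs).filter (Misses C a)) (hst : Stable Q) (hθ : θ ≤ Q.card) :
    ∃ 𝒮 : Finset (Finset (Finset α)), 2 ^ θ ≤ 𝒮.card ∧ ∀ S ∈ 𝒮, Determines M r Cs Hs S := by
  set σ : Finset α → Finset α := fun X => X.image (Equiv.swap a b) with hσ
  have hQ' : ∀ X ∈ Q, X ∈ unforced M r Cs Hs ∧ Misses C a X := fun X hX => mem_filter.1 (hQ hX)
  have hσX : ∀ X ∈ Q, σ X = insert a (X.erase b) := fun X hX =>
    image_swap_eq (hQ' X hX).2.1 ((hQ' X hX).2.mem hb hab)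
  have hσσ : ∀ X, σ (σ X) = X := fun X => by
    simp only [hσ, image_image]
    conv_rhs => rw [← image_id (s := X)]
    exact image_congr fun x _ => by simp
  have hadj : ∀ X ∈ Q, Adj X (σ X) := fun X hX =>
    ⟨b, (hQ' X hX).2.mem hb hab, a, (hQ' X hX).2.1, hσX X hX⟩
  -- Members of Q contain b and not a, transposed ones the reverse, so an adjacency between them
  -- must exchange b for a.
  have hcross : ∀ X ∈ Q, ∀ X' ∈ Q, Adj X (σ X') → X = X' := by
    rintro X hX X' hX' ⟨p, hp, w, hw, h⟩
    have hbX := (hQ' X hX).2.mem hb hab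
    have haX := (hQ' X hX).2.1
    have hbσ : b ∉ σ X' := by rw [hσX X' hX']; simp [hab]
    have haσ : a ∈ σ X' := by rw [hσX X' hX']; simp
    rw [h] at hbσ haσ
    have hpb : b = p := by
      by_contra hne
      exact hbσ (mem_insert_of_mem (mem_erase.2 ⟨hne, hbX⟩))
    have hwa : a = w := by
      rcases mem_insert.1 haσ with e | e
      · exact e
      · exact absurd (mem_of_mem_erase e) haX
    subst hpb hwa
    rw [← hσX X hX] at h
    have := congrArg σ h
    rw [hσσ, hσσ] at this
    exact this.symm
  have hbase : ∀ f ⊆ Q, Stable ((Q \ f) ∪ f.image σ) ∧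
      ((Q \ f) ∪ f.image σ) ⊆ unforced M r Cs Hs := by
    intro f hf
    refine ⟨?_, ?_⟩
    · intro X hX Y hY hXY
      simp only [mem_union, Finset.mem_sdiff, mem_image] at hX hY
      rcases hX with hX | ⟨X', hX', rfl⟩ <;> rcases hY with hY | ⟨Y', hY', rfl⟩
      · exact hst X hX.1 Y hY.1 hXY
      · exact hX.2 (hcross X hX.1 Y' (hf hY') hXY ▸ hY')
      · exact hY.2 (hcross Y hY.1 X' (hf hX') hXY.symm ▸ hX')
      · have := hXY.image (Equiv.swap a b)
        change Adj (σ (σ X')) (σ (σ Y')) at this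
        rw [hσσ, hσσ] at this
        exact hst X' (hf hX') Y' (hf hY') this
    · refine union_subset (fun X hX => (hQ' X (mem_sdiff.1 hX).1).1) fun X hX => ?_
      obtain ⟨X', hX', rfl⟩ := mem_image.1 hX
      rw [hσX X' (hf hX')]
      exact (hQ' X' (hf hX')).2.swap_mem_unforced hM.toCompat hC ha hb hab (hQ' X' (hf hX')).1
  choose! g hg using fun f (hf : f ⊆ Q) => (hbase f hf).1.exists_maximal (hbase f hf).2
  refine ⟨Q.powerset.image g, ?_, ?_⟩
  · rw [card_image_of_injOn, card_powerset]
    · exact Nat.pow_le_pow_right (by norm_num) hθ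
    -- The extension cannot blur f: for X outside f the stable set already contains X, which
    -- excludes its neighbour `σ X`.
    · have hrec : ∀ f ⊆ Q, f = Q.filter fun X => σ X ∈ g f := by
        intro f hf
        ext X
        refine ⟨fun hX => mem_filter.2 ⟨hf hX, (hg f hf).1 (mem_union_right _
          (mem_image_of_mem _ hX))⟩, fun hX => ?_⟩
        obtain ⟨hXQ, hXσ⟩ := mem_filter.1 hX
        by_contra hXf
        exact (hg f hf).2.2.1 X ((hg f hf).1 (mem_union_left _ (mem_sdiff.2 ⟨hXQ, hXf⟩))) _ hXσ
          (hadj X hXQ)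
      intro f hf f' hf' (h : g f = g f')
      rw [hrec f (by simpa using hf), hrec f' (by simpa using hf')]
      rw [h]
  · intro S hS
    obtain ⟨f, hf, rfl⟩ := mem_image.1 hS
    obtain ⟨-, h2, h3, h4⟩ := hg f (mem_powerset.1 hf)
    refine ⟨fun X hX => (mem_unforced.1 (h2 hX)).1, h3, fun M' hM' hS' Y hY => ?_⟩
    refine mem_nonbases.2 ⟨(mem_nonbases.1 hY).1, ?_⟩
    by_cases hYf : Forced r Cs Hs Y
    · exact hYf M' hM'
    · exact hM.not_ind_of_maximal hp hM' Subset.rfl h2 h4 hS' (mem_unforced.2 ⟨hY, hYf⟩)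

open Classical in
-- Supersets of C are dependent in any case, so they can be added to a determining stable set
-- without conveying information. It remains to find many that are pairwise non-adjacent and not
-- adjacent to the stable set; the smallness of Q and the colouring provide them.
lemma IsCode.many_of_small {ι : Type*} [Fintype ι] {col : Finset α → ι}
    (hcol : ∀ X Y, Adj X Y → col X ≠ col Y) {M : Matroid α} {r D d θ : ℕ}
    {Cs Hs : Finset (Finset α)}
    (hp : CodeParams (Fintype.card α) r D d) (hM : IsCode M r D d Cs Hs) {C : Finset α}
    (hC : C ∈ Cs) {a : α} (ha : a ∈ C) {Q : Finset (Finset α)}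
    (hQ : Q ⊆ (unforced M r Cs Hs).filter (Misses C a)) (hst : Stable Q)
    (hmaxQ : ∀ Y ∈ (unforced M r Cs Hs).filter (Misses C a), Y ∈ Q ∨ ∃ Y' ∈ Q, Adj Y Y')
    (hQθ : Q.card ≤ θ)
    (hθ : θ * r + Fintype.card ι * θ ≤ ((univ.powersetCard r).filter fun X => C ⊆ X).card) :
    ∃ 𝒮 : Finset (Finset (Finset α)), 2 ^ θ ≤ 𝒮.card ∧ ∀ S ∈ 𝒮, Determines M r Cs Hs S := by
  set 𝒰 := (univ.powersetCard r).filter fun X => C ⊆ X with h𝒰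
  have hQ' : ∀ X ∈ Q, X ∈ unforced M r Cs Hs ∧ Misses C a X := fun X hX => mem_filter.1 (hQ hX)
  -- Discard the unforced nonbases that miss exactly one element c ≠ a of C; they are recovered at
  -- the end by exchanging c for a. The only remaining ones that can be adjacent to a superset of C
  -- are those missing a alone.
  set A := (unforced M r Cs Hs).filter fun Y => ∀ c ∈ C, Misses C c Y → c = a with hA
  have hQA : Q ⊆ A := fun Y hY => mem_filter.2 ⟨(hQ' Y hY).1, fun c hc hcY => by
    by_contra hne
    exact hcY.1 ((hQ' Y hY).2.mem hc hne)⟩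
  obtain ⟨S, hQS, hSA, hSst, hSmax⟩ := hst.exists_maximal hQA
  have hSQ : ∀ Y ∈ S, Misses C a Y → Y ∈ Q := by
    intro Y hY hYa
    rcases hmaxQ Y (mem_filter.2 ⟨(mem_filter.1 (hSA hY)).1, hYa⟩) with h | ⟨Y', hY', hadj⟩
    · exact h
    · exact absurd hadj (hSst Y hY Y' (hQS hY'))
  have hSC : ∀ Y ∈ S, ¬ C ⊆ Y := fun Y hY hCY =>
    (mem_unforced.1 (mem_filter.1 (hSA hY)).1).2 (forced_of_circ_subset hC hCY)
  -- A superset of C adjacent to Y in Q must gain a, which leaves only the r choices of the removed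
  -- element.
  have hblock : (𝒰.filter fun X => ∃ Y ∈ Q, Adj Y X).card ≤ θ * r := by
    have hsub : (𝒰.filter fun X => ∃ Y ∈ Q, Adj Y X) ⊆
        Q.biUnion fun Y => Y.image fun p => insert a (Y.erase p) := by
      intro X hX
      obtain ⟨hX𝒰, Y, hY, p, hp, w, hw, rfl⟩ := mem_filter.1 hX
      refine mem_biUnion.2 ⟨Y, hY, mem_image.2 ⟨p, hp, ?_⟩⟩
      have haX := (mem_filter.1 hX𝒰).2 ha
      rcases mem_insert.1 haX with e | e
      · rw [e]
      · exact absurd (mem_of_mem_erase e) (hQ' Y hY).2.1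
    refine (card_le_card hsub).trans ((card_biUnion_le_card_mul _ _ r fun Y hY => ?_).trans
      (Nat.mul_le_mul_right _ hQθ))
    exact card_image_le.trans (mem_nonbases.1 (mem_unforced.1 (hQ' Y hY).1).1).1.le
  set 𝒱 := 𝒰.filter fun X => ¬ ∃ Y ∈ Q, Adj Y X with h𝒱
  have hV : Fintype.card ι * θ ≤ 𝒱.card := by
    have : (𝒰.filter fun X => ∃ Y ∈ Q, Adj Y X).card + 𝒱.card = 𝒰.card := by
      rw [h𝒱]
      convert card_filter_add_card_filter_not (s := 𝒰) _
    omega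
  -- A large colour class is a stable family of at least θ free supersets of C.
  obtain ⟨i, -, hi⟩ := exists_le_card_fiber_of_mul_le_card_of_maps_to (s := 𝒱)
    (t := (univ : Finset ι)) (f := col) (fun _ _ => mem_univ _) ⟨col ∅, mem_univ _⟩
    (by simpa using hV)
  set F := 𝒱.filter fun X => col X = i with hF
  have hFmem : ∀ X ∈ F, X.card = r ∧ C ⊆ X ∧ (∀ Y ∈ Q, ¬ Adj Y X) ∧ col X = i := by
    intro X hX
    simp only [hF, h𝒱, h𝒰, mem_filter, mem_powersetCard, not_exists, not_and] at hX
    exact ⟨hX.1.1.1.2, hX.1.1.2, hX.1.2, hX.2⟩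
  have hSF : ∀ X ∈ F, ∀ Y ∈ S, ¬ Adj X Y := by
    rintro X hX Y hY hXY
    have hsymm := hXY.symm
    obtain ⟨-, hCX, hfree, -⟩ := hFmem X hX
    obtain ⟨p, hp, w, hw, rfl⟩ := hXY
    have hpC : p ∈ C := by
      by_contra hpC
      exact hSC _ hY fun x hx => mem_insert_of_mem (mem_erase.2 ⟨fun e => hpC (e ▸ hx), hCX hx⟩)
    have hmiss : Misses C p (insert w (X.erase p)) := by
      refine ⟨?_, ?_⟩
      · have : p ≠ w := fun e => hw (e ▸ hp)
        simp [this]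
      · rw [insert_comm, insert_erase hp]
        exact hCX.trans (subset_insert _ _)
    have hpa : p = a := (mem_filter.1 (hSA hY)).2 p hpC hmiss
    exact hfree _ (hSQ _ hY (hpa ▸ hmiss)) hsymm
  refine ⟨F.powerset.image fun T => S ∪ T, ?_, ?_⟩
  · rw [card_image_of_injOn, card_powerset]
    · exact Nat.pow_le_pow_right (by norm_num) hi
    -- No member of S contains C, because such a set would be forced; hence T can be read off.
    · have hrec : ∀ T ⊆ F, T = (S ∪ T).filter fun X => C ⊆ X := by
        intro T hT
        ext X
        simp only [mem_filter, mem_union]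
        refine ⟨fun h => ⟨Or.inr h, (hFmem X (hT h)).2.1⟩, ?_⟩
        rintro ⟨h | h, hCX⟩
        · exact absurd hCX (hSC X h)
        · exact h
      intro T hT T' hT' (h : S ∪ T = S ∪ T')
      rw [hrec T (by simpa using hT), hrec T' (by simpa using hT')]
      rw [h]
  · intro S' hS'
    obtain ⟨T, hT, rfl⟩ := mem_image.1 hS'
    rw [mem_powerset] at hT
    refine ⟨union_subset (fun X hX => (mem_unforced.1 (mem_filter.1 (hSA hX)).1).1) fun X hX =>
      mem_nonbases.2 ⟨(hFmem X (hT hX)).1, fun hind =>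
        (hM.circ C hC).not_subset hind (hFmem X (hT hX)).2.1⟩, ?_, ?_⟩
    · intro X hX Y hY hXY
      rcases mem_union.1 hX with hX | hX <;> rcases mem_union.1 hY with hY | hY
      · exact hSst X hX Y hY hXY
      · exact hSF Y (hT hY) X hX hXY.symm
      · exact hSF X (hT hX) Y hY hXY
      · exact hcol X Y hXY ((hFmem X (hT hX)).2.2.2.trans (hFmem Y (hT hY)).2.2.2.symm)
    · intro M' hM' hS' Y hY
      refine mem_nonbases.2 ⟨(mem_nonbases.1 hY).1, ?_⟩
      by_cases hYf : Forced r Cs Hs Y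
      · exact hYf M' hM'
      have hYU : Y ∈ unforced M r Cs Hs := mem_unforced.2 ⟨hY, hYf⟩
      have hdet : ∀ Z ∈ A, ¬ Ind M' Z := fun Z hZ =>
        hM.not_ind_of_maximal hp hM' (filter_subset _ _) hSA hSmax
          (subset_union_left.trans hS') hZ
      by_cases hYA : Y ∈ A
      · exact hdet Y hYA
      · obtain ⟨c, hc, hmiss, hca⟩ : ∃ c ∈ C, Misses C c Y ∧ c ≠ a := by
          by_contra! hcon
          exact hYA (mem_filter.2 ⟨hYU, hcon⟩)
        have h1 := hmiss.swap_mem_unforced hM.toCompat hC hc ha hca.symm hYU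
        have h2 := hmiss.swap hca.symm
        intro hind
        refine hdet _ (mem_filter.2 ⟨h1, fun e he hme => ?_⟩)
          (hmiss.ind_swap (hM'.circ C hC) ha hca.symm hind)
        by_contra hne
        exact hme.1 (h2.mem he hne)

open Classical in
/-- A matroid with a code containing a circuit `C` with at least two elements is determined by many
stable sets. -/
theorem IsCode.exists_many {ι : Type*} [Fintype ι] {col : Finset α → ι}
    (hcol : ∀ X Y, Adj X Y → col X ≠ col Y) {M : Matroid α} {r D d θ : ℕ}
    {Cs Hs : Finset (Finset α)}
    (hp : CodeParams (Fintype.card α) r D d) (hM : IsCode M r D d Cs Hs) {C : Finset α}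
    (hC : C ∈ Cs) (hC2 : 2 ≤ C.card)
    (hθ : θ * r + Fintype.card ι * θ ≤ ((univ.powersetCard r).filter fun X => C ⊆ X).card) :
    ∃ 𝒮 : Finset (Finset (Finset α)), 2 ^ θ ≤ 𝒮.card ∧ ∀ S ∈ 𝒮, Determines M r Cs Hs S := by
  obtain ⟨a, ha, b, hb, hab⟩ := one_lt_card.1 hC2
  have hst : Stable (∅ : Finset (Finset α)) := fun X hX => by simp at hX
  obtain ⟨Q, -, hQ, hQst, hQmax⟩ := hst.exists_maximal
    (empty_subset ((unforced M r Cs Hs).filter (Misses C a)))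
  rcases le_total θ Q.card with h | h
  · exact hM.many_of_large hp hC ha hb hab.symm hQ hQst h
  · exact hM.many_of_small hcol hp hC ha hQ hQst hQmax h hθ

end MatroidGirth

namespace MatroidGirth

open Finset

/-! ### Hitting sets -/

open Classical in
lemma exists_mem_hitting_many {β γ : Type*} (B : Finset β) (Ys : Finset γ) (R : γ → β → Prop)
    (δ : ℕ) (h : ∀ Y ∈ Ys, δ ≤ (B.filter (R Y)).card) (hne : B.Nonempty) :
    ∃ b ∈ B, Ys.card * δ ≤ B.card * (Ys.filter fun Y => R Y b).card := by
  have h1 : Ys.card * δ ≤ ∑ b ∈ B, (Ys.filter fun Y => R Y b).card := by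
    have := sum_card_bipartiteAbove_eq_sum_card_bipartiteBelow (s := Ys) (t := B) R
    simp only [bipartiteAbove, bipartiteBelow] at this
    rw [← this, ← smul_eq_mul]
    exact card_nsmul_le_sum _ _ _ h
  obtain ⟨b, hb, hmax⟩ := exists_max_image B (fun b => (Ys.filter fun Y => R Y b).card) hne
  exact ⟨b, hb, h1.trans (by
    rw [← smul_eq_mul]
    exact sum_le_card_nsmul _ _ _ hmax)⟩

open Classical in
-- Greedy choice: by averaging some element hits a fraction δ/|B| of the remaining sets. After t
-- steps the survivors are hit one by one.
lemma exists_hitting_of_steps {β γ : Type*} (B : Finset β) (R : γ → β → Prop)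
    (δ : ℕ) (hδ : 0 < δ) (t : ℕ) (Ys : Finset γ) (h : ∀ Y ∈ Ys, δ ≤ (B.filter (R Y)).card) :
    ∃ T ⊆ B, (∀ Y ∈ Ys, ∃ X ∈ T, R Y X) ∧
      (T.card : ℝ) ≤ t + Ys.card * (1 - (δ : ℝ) / B.card) ^ t := by
  induction t generalizing Ys with
  | zero =>
    have hex : ∀ Y ∈ Ys, ∃ X ∈ B, R Y X := fun Y hY => by
      obtain ⟨X, hX⟩ := card_pos.1 (hδ.trans_le (h Y hY))
      exact ⟨X, (mem_filter.1 hX).1, (mem_filter.1 hX).2⟩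
    rcases Ys.eq_empty_or_nonempty with rfl | ⟨Y0, hY0⟩
    · exact ⟨∅, empty_subset _, by simp, by simp⟩
    have : Nonempty β := ⟨(hex Y0 hY0).choose⟩
    choose! f hf using hex
    refine ⟨Ys.image f, ?_, fun Y hY => ⟨f Y, mem_image_of_mem _ hY, (hf Y hY).2⟩, ?_⟩
    · intro X hX
      obtain ⟨Y, hY, rfl⟩ := mem_image.1 hX
      exact (hf Y hY).1
    · simpa using card_image_le
  | succ t ih =>
    rcases Ys.eq_empty_or_nonempty with rfl | ⟨Y0, hY0⟩
    · exact ⟨∅, empty_subset _, by simp, by simp; positivity⟩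
    have hδB : δ ≤ B.card := (h Y0 hY0).trans (card_filter_le _ _)
    have hBpos : 0 < B.card := hδ.trans_le hδB
    obtain ⟨b, hb, hcount⟩ := exists_mem_hitting_many B Ys R δ h (card_pos.1 hBpos)
    obtain ⟨T, hTB, hT, hTc⟩ := ih (Ys.filter fun Y => ¬ R Y b)
      fun Y hY => h Y (mem_filter.1 hY).1
    refine ⟨insert b T, insert_subset hb hTB, fun Y hY => ?_, ?_⟩
    · by_cases hYb : R Y b
      · exact ⟨b, mem_insert_self _ _, hYb⟩
      · obtain ⟨X, hX, hR⟩ := hT Y (mem_filter.2 ⟨hY, hYb⟩)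
        exact ⟨X, mem_insert_of_mem hX, hR⟩
    · have hB' : (0 : ℝ) < B.card := by exact_mod_cast hBpos
      have hx0 : 0 ≤ 1 - (δ : ℝ) / B.card := by
        rw [sub_nonneg, div_le_one hB']; exact_mod_cast hδB
      have hsum : ((Ys.filter fun Y => R Y b).card : ℝ) + (Ys.filter fun Y => ¬ R Y b).card
          = Ys.card := by
        exact_mod_cast card_filter_add_card_filter_not (s := Ys) _
      have hcount' : (Ys.card : ℝ) * δ ≤ B.card * (Ys.filter fun Y => R Y b).card := by
        exact_mod_cast hcount
      have hle : ((Ys.filter fun Y => ¬ R Y b).card : ℝ) ≤ Ys.card * (1 - (δ : ℝ) / B.card) := by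
        have : (Ys.card : ℝ) * ((δ : ℝ) / B.card) ≤ (Ys.filter fun Y => R Y b).card := by
          rw [← mul_div_assoc, div_le_iff₀ hB']; linarith
        linarith
      calc ((insert b T).card : ℝ) ≤ T.card + 1 := by exact_mod_cast card_insert_le _ _
        _ ≤ t + (Ys.filter fun Y => ¬ R Y b).card * (1 - (δ : ℝ) / B.card) ^ t + 1 := by linarith
        _ ≤ t + (Ys.card * (1 - (δ : ℝ) / B.card)) * (1 - (δ : ℝ) / B.card) ^ t + 1 := by gcongr
        _ = ((t + 1 : ℕ) : ℝ) + Ys.card * (1 - (δ : ℝ) / B.card) ^ (t + 1) := by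
          push_cast; ring

open Classical in
lemma exists_hitting {β γ : Type*} (B : Finset β) (R : γ → β → Prop)
    (δ : ℕ) (hδ : 0 < δ) {L : ℝ} (hL : 0 ≤ L) (Ys : Finset γ)
    (h : ∀ Y ∈ Ys, δ ≤ (B.filter (R Y)).card) :
    ∃ T ⊆ B, (∀ Y ∈ Ys, ∃ X ∈ T, R Y X) ∧
      (T.card : ℝ) ≤ B.card / δ * L + 1 + Ys.card * Real.exp (-L) := by
  rcases Ys.eq_empty_or_nonempty with rfl | ⟨Y0, hY0⟩
  · exact ⟨∅, empty_subset _, by simp, by simp; positivity⟩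
  have hδB : δ ≤ B.card := (h Y0 hY0).trans (card_filter_le _ _)
  have hB' : (0 : ℝ) < B.card := by exact_mod_cast hδ.trans_le hδB
  have hδ' : (0 : ℝ) < δ := by exact_mod_cast hδ
  have hx0 : 0 ≤ 1 - (δ : ℝ) / B.card := by
    rw [sub_nonneg, div_le_one hB']; exact_mod_cast hδB
  set t := ⌈(B.card : ℝ) / δ * L⌉₊ with ht
  obtain ⟨T, hTB, hT, hc⟩ := exists_hitting_of_steps B R δ hδ t Ys h
  refine ⟨T, hTB, hT, hc.trans ?_⟩
  have h1 : (t : ℝ) ≤ B.card / δ * L + 1 := (Nat.ceil_lt_add_one (by positivity)).le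
  have h2 : (1 - (δ : ℝ) / B.card) ^ t ≤ Real.exp (-L) := by
    calc (1 - (δ : ℝ) / B.card) ^ t ≤ (Real.exp (-((δ : ℝ) / B.card))) ^ t := by
          gcongr
          have := Real.add_one_le_exp (-((δ : ℝ) / B.card))
          linarith
      _ = Real.exp (-((δ : ℝ) / B.card * t)) := by
          rw [← Real.exp_nat_mul]; ring_nf
      _ ≤ Real.exp (-L) := by
          have : (B.card : ℝ) / δ * L ≤ t := Nat.le_ceil _
          have h3 : (δ : ℝ) / B.card * (B.card / δ * L) ≤ δ / B.card * t := by gcongr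
          have h4 : (δ : ℝ) / B.card * (B.card / δ * L) = L := by field_simp
          rw [h4] at h3
          gcongr
  gcongr

/-! ### Families of small degree in the Johnson graph -/

variable {α : Type*} [DecidableEq α]

lemma adj_of_subset_of_subset {X Y V : Finset α} {r : ℕ} (hX : X.card = r + 1)
    (hY : Y.card = r + 1) (hne : X ≠ Y) (hV : V.card = r) (hVX : V ⊆ X) (hVY : V ⊆ Y) :
    Adj X Y ∧ V = X ∩ Y := by
  have hlt : (X ∩ Y).card < r + 1 := by
    by_contra h
    have h1 : X ∩ Y = X := eq_of_subset_of_card_le inter_subset_left (by omega)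
    have h2 : X ∩ Y = Y := eq_of_subset_of_card_le inter_subset_right (by omega)
    exact hne (h1.symm.trans h2)
  have hVe : V = X ∩ Y := eq_of_subset_of_card_le (subset_inter hVX hVY) (by omega)
  refine ⟨?_, hVe⟩
  have hX1 : (X \ Y).card = 1 := by
    have := card_sdiff_add_card_inter X Y
    rw [← hVe] at this; omega
  have hY1 : (Y \ X).card = 1 := by
    have := card_sdiff_add_card_inter Y X
    rw [inter_comm, ← hVe] at this; omega
  obtain ⟨p, hp⟩ := card_eq_one.1 hX1
  obtain ⟨w, hw⟩ := card_eq_one.1 hY1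
  have hp' : p ∈ X \ Y := hp ▸ mem_singleton_self p
  have hw' : w ∈ Y \ X := hw ▸ mem_singleton_self w
  rw [Finset.mem_sdiff] at hp' hw'
  refine ⟨p, hp'.1, w, hw'.2, ?_⟩
  ext x
  have hx1 : x ∈ X \ Y ↔ x = p := by rw [hp, mem_singleton]
  have hx2 : x ∈ Y \ X ↔ x = w := by rw [hw, mem_singleton]
  rw [Finset.mem_sdiff] at hx1 hx2
  rw [mem_insert, mem_erase]
  tauto

variable [Fintype α]

open Classical in
-- Apply Cauchy–Schwarz to the number of members of B above each r-set V. In the second moment, a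
-- pair X ≠ Y shares at most one r-set, and only if adjacent, so each X contributes at most r + 1 +
-- D.
lemma card_mul_sq_le_of_degree_le {r D : ℕ} {B : Finset (Finset α)}
    (hB : ∀ X ∈ B, X.card = r + 1) (hD : ∀ X ∈ B, (B.filter (Adj X)).card ≤ D) :
    B.card * (r + 1) ^ 2 ≤ (Fintype.card α).choose r * (r + 1 + D) := by
  set P := (univ : Finset α).powersetCard r with hP
  have hPc : P.card = (Fintype.card α).choose r := by rw [hP, card_powersetCard, card_univ]
  have h1 : ∑ V ∈ P, (B.filter fun X => V ⊆ X).card = B.card * (r + 1) := by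
    have := sum_card_bipartiteAbove_eq_sum_card_bipartiteBelow (s := P) (t := B)
      (fun V X => V ⊆ X)
    simp only [bipartiteAbove, bipartiteBelow] at this
    rw [this, ← smul_eq_mul, ← sum_const]
    refine sum_congr rfl fun X hX => ?_
    have : P.filter (fun V => V ⊆ X) = X.powersetCard r := by
      ext V; simp [hP, mem_powersetCard, and_comm]
    rw [this, card_powersetCard, hB X hX, Nat.choose_succ_self_right]
  have h2 : ∑ V ∈ P, (B.filter fun X => V ⊆ X).card ^ 2 ≤ B.card * (r + 1 + D) := by
    have hsq : ∀ V ∈ P, (B.filter fun X => V ⊆ X).card ^ 2 =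
        ∑ X ∈ B, ∑ Y ∈ B, if V ⊆ X ∧ V ⊆ Y then 1 else 0 := by
      intro V _
      rw [sq, ← card_product, ← sum_product', ← card_filter]
      congr 1
      ext ⟨X, Y⟩
      simp only [mem_product, mem_filter]
      tauto
    rw [sum_congr rfl hsq, sum_comm, ← smul_eq_mul]
    refine sum_le_card_nsmul _ _ _ fun X hX => ?_
    rw [sum_comm]
    have hterm : ∀ Y ∈ B, (∑ V ∈ P, if V ⊆ X ∧ V ⊆ Y then 1 else 0) ≤
        (if Y = X then r + 1 else 0) + if Adj X Y then 1 else 0 := by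
      intro Y hY
      rw [← card_filter]
      by_cases hYX : Y = X
      · subst hYX
        have : P.filter (fun V => V ⊆ Y ∧ V ⊆ Y) = Y.powersetCard r := by
          ext V; simp [hP, mem_powersetCard, and_comm]
        rw [this, card_powersetCard, hB Y hX, Nat.choose_succ_self_right]
        simp
      · rw [if_neg hYX, zero_add]
        rcases (P.filter fun V => V ⊆ X ∧ V ⊆ Y).eq_empty_or_nonempty with h | ⟨V, hV⟩
        · rw [h]; simp
        · have hkey : ∀ V ∈ P.filter (fun V => V ⊆ X ∧ V ⊆ Y), Adj X Y ∧ V = X ∩ Y := by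
            intro V hV
            simp only [hP, mem_filter, mem_powersetCard] at hV
            exact adj_of_subset_of_subset (hB X hX) (hB Y hY) (Ne.symm hYX) hV.1.2 hV.2.1 hV.2.2
          rw [if_pos (hkey V hV).1, card_le_one]
          intro V1 hV1 V2 hV2
          rw [(hkey V1 hV1).2, (hkey V2 hV2).2]
    refine (sum_le_sum hterm).trans ?_
    rw [sum_add_distrib, sum_ite_eq' B X, if_pos hX, ← card_filter]
    exact Nat.add_le_add_left (hD X hX) _
  have h3 := sq_sum_le_card_mul_sum_sq (s := P) (f := fun V => (B.filter fun X => V ⊆ X).card)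
  rw [h1, hPc] at h3
  rcases Nat.eq_zero_or_pos B.card with h0 | hpos
  · rw [h0]; simp
  refine Nat.le_of_mul_le_mul_left ?_ hpos
  calc B.card * (B.card * (r + 1) ^ 2) = (B.card * (r + 1)) ^ 2 := by ring
    _ ≤ _ := h3
    _ ≤ (Fintype.card α).choose r * (B.card * (r + 1 + D)) := Nat.mul_le_mul_left _ h2
    _ = _ := by ring

/-! ### Existence of codes -/

lemma card_nonbases_le (M : Matroid α) (r : ℕ) :
    (nonbases M r).card ≤ (Fintype.card α).choose r := by
  classical
  refine (card_filter_le _ _).trans ?_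
  rw [card_powersetCard, card_univ]

lemma card_sparsePart_mul_le (M : Matroid α) (r D : ℕ) :
    (sparsePart M (r + 1) D).card * (r + 1) ^ 2 ≤ (Fintype.card α).choose r * (r + 1 + D) := by
  classical
  refine card_mul_sq_le_of_degree_le (fun X hX => ?_) fun X hX => ?_
  · exact (mem_nonbases.1 (mem_filter.1 (mem_filter.1 hX).1).1).1
  · refine le_trans (card_le_card ?_) (mem_filter.1 hX).2.le
    exact filter_subset_filter _ (filter_subset _ _)

/-- A bound for the number of sets needed to hit all neighbourhoods of size at least `δ`. -/
noncomputable def hitBound (b N δ L : ℝ) : ℝ := b / δ * L + 1 + N * Real.exp (-L)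

open Classical in
-- Hit the large neighbourhoods in each of the three families separately; the sparse family is
-- small, which is why the lower threshold d is affordable there. Record two circuits for each
-- hitting set in `corankTwo`, and a circuit with a hyperplane for the others.
lemma exists_isCode {M : Matroid α} {r D d : ℕ} (hD : 0 < D) (hd : 0 < d) {L : ℝ} (hL : 0 ≤ L)
    {C : Finset α} (hC : IsCirc M C) :
    ∃ Cs Hs, IsCode M r D d Cs Hs ∧ C ∈ Cs ∧
      (Cs.card : ℝ) ≤ 1 + (3 * hitBound ((Fintype.card α).choose r) ((Fintype.card α).choose r) D L
        + hitBound (sparsePart M r D).card ((Fintype.card α).choose r) d L) ∧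
      (Hs.card : ℝ) ≤ 1 + (3 * hitBound ((Fintype.card α).choose r) ((Fintype.card α).choose r) D L
        + hitBound (sparsePart M r D).card ((Fintype.card α).choose r) d L) := by
  have hit : ∀ (B : Finset (Finset α)) (b : ℝ) (δ : ℕ), 0 < δ → (B.card : ℝ) ≤ b →
      ∃ T ⊆ B, (∀ Y ∈ nonbases M r, δ ≤ (B.filter (Adj Y)).card → ∃ X ∈ T, Adj X Y) ∧
        (T.card : ℝ) ≤ hitBound b ((Fintype.card α).choose r) δ L := by
    intro B b δ hδ hb
    obtain ⟨T, hTB, hT, hc⟩ := exists_hitting B Adj δ hδ hL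
      ((nonbases M r).filter fun Y => δ ≤ (B.filter (Adj Y)).card)
      fun Y hY => (mem_filter.1 hY).2
    refine ⟨T, hTB, fun Y hY h => ?_, hc.trans ?_⟩
    · obtain ⟨X, hX, hadj⟩ := hT Y (mem_filter.2 ⟨hY, h⟩)
      exact ⟨X, hX, hadj.symm⟩
    · have : (((nonbases M r).filter fun Y => δ ≤ (B.filter (Adj Y)).card).card : ℝ) ≤
          (Fintype.card α).choose r := by
        exact_mod_cast (card_filter_le _ _).trans (card_nonbases_le M r)
      unfold hitBound
      gcongr
  have hle1 : (corankOne M r).card ≤ (Fintype.card α).choose r :=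
    (card_filter_le _ _).trans (card_nonbases_le M r)
  have hle2 : (corankTwo M r).card ≤ (Fintype.card α).choose r :=
    (card_filter_le _ _).trans (card_nonbases_le M r)
  obtain ⟨T0, hT0, h0, hc0⟩ := hit (corankTwo M r) _ D hD (Nat.cast_le.2 hle2)
  obtain ⟨T1, hT1, h1, hc1⟩ := hit (corankOne M r) _ D hD (Nat.cast_le.2 hle1)
  obtain ⟨T2, hT2, h2, hc2⟩ := hit (sparsePart M r D) _ d hd le_rfl
  choose! A A' hA using fun X (hX : X ∈ T0) => exists_two_circuits (hT0 hX)
  have hT12 : ∀ X ∈ T1 ∪ T2, X ∈ corankOne M r := fun X hX => by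
    rcases mem_union.1 hX with h | h
    · exact hT1 h
    · exact (mem_filter.1 (hT2 h)).1
  choose! E F hEF using fun X (hX : X ∈ T1 ∪ T2) => exists_circuit_hyperplane (hT12 X hX)
  set Cs := insert C (T0.image A ∪ T0.image A' ∪ (T1 ∪ T2).image E) with hCs
  set Hs := (T1 ∪ T2).image F with hHs
  have hpin : ∀ X ∈ T1 ∪ T2, Pinned M r Cs Hs X := by
    intro X hX
    obtain ⟨-, -, p1, p2, p3⟩ := hEF X hX
    refine ⟨(mem_filter.1 (hT12 X hX)).1, E X, ?_, F X, ?_, p1, p2, p3⟩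
    · exact mem_insert_of_mem (mem_union_right _ (mem_image_of_mem _ hX))
    · exact mem_image_of_mem _ hX
  refine ⟨Cs, Hs, ⟨⟨?_, ?_⟩, ?_, ?_, ?_⟩, mem_insert_self _ _, ?_, ?_⟩
  · intro X hX
    simp only [hCs, mem_insert, mem_union (s := _ ∪ _), mem_union (s := image _ _),
      mem_image (s := T0), mem_image (s := T1 ∪ T2)] at hX
    rcases hX with rfl | (⟨Y, hY, rfl⟩ | ⟨Y, hY, rfl⟩) | ⟨Y, hY, rfl⟩
    · exact hC
    · exact (hA Y hY).1
    · exact (hA Y hY).2.1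
    · exact (hEF Y hY).1
  · intro X hX
    obtain ⟨Y, hY, rfl⟩ := mem_image.1 hX
    exact (hEF Y hY).2.1
  · intro Y hY h
    obtain ⟨X, hX, hadj⟩ := h0 Y hY h
    obtain ⟨-, -, q1, q2, q3⟩ := hA X hX
    refine forced_of_two_circuits (C := A X) (C' := A' X) ?_ ?_ q1 q2 q3 hadj
    · exact mem_insert_of_mem (mem_union_left _ (mem_union_left _ (mem_image_of_mem _ hX)))
    · exact mem_insert_of_mem (mem_union_left _ (mem_union_right _ (mem_image_of_mem _ hX)))
  · intro Y hY h
    obtain ⟨X, hX, hadj⟩ := h1 Y hY h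
    exact ⟨X, hadj, hpin X (mem_union_left _ hX)⟩
  · intro Y hY h
    obtain ⟨X, hX, hadj⟩ := h2 Y hY h
    exact ⟨X, hadj, hpin X (mem_union_right _ hX)⟩
  -- The factor 3 arises because each set in `T0` yields two circuits and each set in `T1` one.
  · have : Cs.card ≤ T0.card + T0.card + (T1.card + T2.card) + 1 := by
      refine (card_insert_le _ _).trans (Nat.add_le_add_right ?_ 1)
      refine (card_union_le _ _).trans (Nat.add_le_add ?_ ?_)
      · exact (card_union_le _ _).trans (Nat.add_le_add card_image_le card_image_le)
      · exact card_image_le.trans (card_union_le _ _)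
    have : (Cs.card : ℝ) ≤ T0.card + T0.card + (T1.card + T2.card) + 1 := by exact_mod_cast this
    linarith
  · have : Hs.card ≤ T1.card + T2.card := card_image_le.trans (card_union_le _ _)
    have : (Hs.card : ℝ) ≤ T1.card + T2.card := by exact_mod_cast this
    have : (0 : ℝ) ≤ T0.card := by positivity
    have : (0 : ℝ) ≤ T1.card := by positivity
    linarith

end MatroidGirth

namespace MatroidGirth

open Finset

variable {α : Type*} [DecidableEq α]

/-! ### Matroids of given rank -/

lemma HasRank.card_le {M : Matroid α} {r : ℕ} (hM : HasRank M r) {X : Finset α} (hX : Ind M X) :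
    X.card ≤ r := by
  obtain ⟨-, B, hB, rfl⟩ := hM
  have := Matroid.Indep.encard_le_eRank hX
  rw [← hB.encard_eq_eRank, Set.encard_coe_eq_coe_finsetCard, Set.encard_coe_eq_coe_finsetCard]
    at this
  exact_mod_cast this

lemma HasRank.isBase_iff {M : Matroid α} {r : ℕ} (hM : HasRank M r) {X : Finset α} :
    M.IsBase (X : Set α) ↔ X.card = r ∧ Ind M X := by
  refine ⟨fun h => ⟨?_, h.indep⟩, fun ⟨hc, hi⟩ => ?_⟩
  · obtain ⟨-, B, hB, rfl⟩ := hM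
    simpa using h.ncard_eq_ncard_of_isBase hB
  · refine Matroid.Indep.isBase_of_forall_insert hi fun e he hind => ?_
    have he' : e ∉ X := fun h => he.2 (mem_coe.2 h)
    have : Ind M (insert e X) := by simpa [Ind] using hind
    have := hM.card_le this
    rw [card_insert_of_notMem he'] at this
    omega

variable [Fintype α]

lemma HasRank.eq_of_nonbases {M M' : Matroid α} {r : ℕ} (hM : HasRank M r) (hM' : HasRank M' r)
    (h : nonbases M r = nonbases M' r) : M = M' := by
  classical
  refine Matroid.ext_isBase (hM.1.trans hM'.1.symm) fun B _ => ?_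
  obtain ⟨X, rfl⟩ : ∃ X : Finset α, (X : Set α) = B := ⟨B.toFinset, by simp⟩
  rw [hM.isBase_iff, hM'.isBase_iff]
  have := Finset.ext_iff.1 h X
  rw [mem_nonbases, mem_nonbases] at this
  tauto

instance finite_matroid : Finite (Matroid α) := by
  have := Matroid.finite_setOfPred_matroid (E := (Set.univ : Set α)) Set.finite_univ
  have h : {M : Matroid α | M.E ⊆ Set.univ} = Set.univ := by ext; simp
  rw [h] at this
  exact Set.finite_univ_iff.1 this

lemma exists_hasRank {M : Matroid α} (hM : M.E = Set.univ) :
    ∃ r ≤ Fintype.card α, HasRank M r := by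
  classical
  obtain ⟨B, hB⟩ := M.exists_isBase
  exact ⟨B.toFinset.card, card_le_univ _, hM, B.toFinset, by simpa using hB, rfl⟩

lemma ncard_hasRank_le (r : ℕ) :
    {M : Matroid α | HasRank M r}.ncard ≤ 2 ^ (Fintype.card α).choose r := by
  classical
  have h := Set.ncard_le_ncard_of_injOn (s := {M : Matroid α | HasRank M r})
    (t := (((univ : Finset α).powersetCard r).powerset : Set (Finset (Finset α))))
    (fun M => nonbases M r) (fun M _ => by
      simp only [coe_powerset, Set.mem_preimage, Set.mem_powerset_iff]
      exact_mod_cast filter_subset _ _)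
    (fun M hM M' hM' h => HasRank.eq_of_nonbases hM hM' h)
    (Finset.finite_toSet _)
  rwa [Set.ncard_coe_finset, card_powerset, card_powersetCard, card_univ] at h

/-! ### Sparse paving matroids -/

open Classical in
/-- The stable sets of the Johnson graph on the `r`-sets. -/
noncomputable def stableSets (α : Type*) [DecidableEq α] [Fintype α] (r : ℕ) :
    Finset (Finset (Finset α)) :=
  ((univ : Finset α).powersetCard r).powerset.filter Stable

lemma mem_stableSets {r : ℕ} {S : Finset (Finset α)} :
    S ∈ stableSets α r ↔ (∀ X ∈ S, X.card = r) ∧ Stable S := by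
  simp [stableSets, subset_iff, mem_powersetCard]

lemma exists_notMem_stable {r : ℕ} (hr : 0 < r) (hrn : r < Fintype.card α) {S : Finset (Finset α)}
    (hS : Stable S) : ∃ X : Finset α, X.card = r ∧ X ∉ S := by
  obtain ⟨X, -, hX⟩ := exists_subset_card_eq (s := (univ : Finset α)) (n := r)
    (by rw [card_univ]; exact hrn.le)
  by_cases hXS : X ∈ S
  · obtain ⟨p, hp⟩ := card_pos.1 (hX ▸ hr)
    obtain ⟨w, hw⟩ : ∃ w, w ∉ X := by
      by_contra! h
      have : X = univ := eq_univ_iff_forall.2 h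
      rw [this, card_univ] at hX
      omega
    have hadj : Adj X (insert w (X.erase p)) := ⟨p, hp, w, hw, rfl⟩
    exact ⟨_, hadj.card_eq.trans hX, fun h => hS X hXS _ h hadj⟩
  · exact ⟨X, hX, hXS⟩

/-- Basis exchange fails only if all candidate sets X - a + b lie in S. Two candidates are adjacent,
contradicting stability, and a single candidate is Y itself, which is a basis. -/
lemma exists_sparse_paving {r : ℕ} (hr : 0 < r) (hrn : r < Fintype.card α)
    {S : Finset (Finset α)} (hS : S ∈ stableSets α r) :
    ∃ M : Matroid α, HasRank M r ∧ nonbases M r = S := by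
  classical
  obtain ⟨hSr, hst⟩ := mem_stableSets.1 hS
  obtain ⟨X0, hX0, hX0S⟩ := exists_notMem_stable hr hrn hst
  have hex : Matroid.ExchangeProperty
      (fun B : Set α => ∃ X : Finset α, (X : Set α) = B ∧ X.card = r ∧ X ∉ S) := by
    rintro _ _ ⟨X, rfl, hX, hXS⟩ ⟨Y, rfl, hY, hYS⟩ a ha
    have haX : a ∈ X := by simpa using ha.1
    have haY : a ∉ Y := by simpa using ha.2
    suffices h : ∃ b ∈ Y \ X, insert b (X.erase a) ∉ S by
      obtain ⟨b, hb, hbS⟩ := h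
      have hb' := Finset.mem_sdiff.1 hb
      exact ⟨b, ⟨mem_coe.2 hb'.1, fun h => hb'.2 (mem_coe.1 h)⟩, insert b (X.erase a), by simp,
        (card_exchange haX hb'.2).trans hX, hbS⟩
    by_contra! hcon
    have hcard : (Y \ X).card = (X \ Y).card := by
      have h1 := card_sdiff_add_card_inter X Y
      have h2 := card_sdiff_add_card_inter Y X
      rw [inter_comm] at h2
      omega
    have hpos : 0 < (Y \ X).card := by
      rw [hcard]; exact card_pos.2 ⟨a, Finset.mem_sdiff.2 ⟨haX, haY⟩⟩
    rcases Nat.lt_or_ge 1 (Y \ X).card with h2 | h1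
    · obtain ⟨b, hb, b', hb', hne⟩ := one_lt_card.1 h2
      have hbX := (Finset.mem_sdiff.1 hb).2
      have hbX' := (Finset.mem_sdiff.1 hb').2
      refine hst _ (hcon b hb) _ (hcon b' hb') ⟨b, mem_insert_self _ _, b', ?_, ?_⟩
      · simp [hbX', Ne.symm hne]
      · rw [erase_insert (by simp [hbX])]
    · obtain ⟨b, hb⟩ := card_eq_one.1 (le_antisymm h1 hpos)
      obtain ⟨a', ha'⟩ := card_eq_one.1 (hcard ▸ le_antisymm h1 hpos)
      have haa : a = a' := by
        rw [← mem_singleton, ← ha']; exact Finset.mem_sdiff.2 ⟨haX, haY⟩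
      subst haa
      have hbm : b ∈ Y \ X := hb ▸ mem_singleton_self b
      have hYe : insert b (X.erase a) = Y := by
        ext x
        have e1 : x ∈ X \ Y ↔ x = a := by rw [ha', mem_singleton]
        have e2 : x ∈ Y \ X ↔ x = b := by rw [hb, mem_singleton]
        rw [Finset.mem_sdiff] at e1 e2
        rw [mem_insert, mem_erase]
        tauto
      exact hYS (hYe ▸ hcon b hbm)
  set M : Matroid α := Matroid.ofIsBaseOfFinite (Set.finite_univ (α := α)) _
    ⟨_, X0, rfl, hX0, hX0S⟩ hex (fun _ _ => Set.subset_univ _) with hM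
  have hbase : ∀ X : Finset α, M.IsBase (X : Set α) ↔ X.card = r ∧ X ∉ S := by
    intro X
    rw [hM, Matroid.ofIsBaseOfFinite_isBase]
    refine ⟨?_, fun h => ⟨X, rfl, h⟩⟩
    rintro ⟨Y, hYX, h⟩
    rwa [← Finset.coe_injective hYX]
  have hrank : HasRank M r := ⟨rfl, X0, (hbase X0).2 ⟨hX0, hX0S⟩, hX0⟩
  refine ⟨M, hrank, ?_⟩
  ext X
  rw [mem_nonbases]
  have h1 := hbase X
  have h2 := hrank.isBase_iff (X := X)
  have h3 := hSr X
  tauto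

lemma card_stableSets_le {r : ℕ} (hr : 0 < r) (hrn : r < Fintype.card α) :
    (stableSets α r).card ≤ {M : Matroid α | HasRank M r}.ncard := by
  have : Nonempty (Matroid α) := ⟨Matroid.freeOn Set.univ⟩
  choose! f hf using fun S (hS : S ∈ stableSets α r) => exists_sparse_paving hr hrn hS
  rw [← Set.ncard_coe_finset]
  refine Set.ncard_le_ncard_of_injOn f (fun S hS => (hf S hS).1) ?_ (Set.toFinite _)
  intro S hS S' hS' h
  rw [← (hf S hS).2, ← (hf S' hS').2, h]

lemma pow_le_card_stableSets {ι : Type*} [Fintype ι] {col : Finset α → ι}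
    (hcol : ∀ X Y, Adj X Y → col X ≠ col Y) {r q : ℕ}
    (hq : Fintype.card ι * q ≤ (Fintype.card α).choose r) :
    2 ^ q ≤ (stableSets α r).card := by
  classical
  obtain ⟨i, -, hi⟩ := exists_le_card_fiber_of_mul_le_card_of_maps_to
    (s := (univ : Finset α).powersetCard r) (t := (univ : Finset ι)) (f := col) (n := q)
    (fun _ _ => mem_univ _) ⟨col ∅, mem_univ _⟩ (by rw [card_powersetCard, card_univ, card_univ]; exact hq)
  refine (Nat.pow_le_pow_right (by norm_num) hi).trans ?_
  rw [← card_powerset]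
  refine card_le_card fun S hS => ?_
  have hS' : ∀ X ∈ S, X.card = r ∧ col X = i := fun X hX => by
    simpa [mem_powersetCard] using mem_powerset.1 hS hX
  exact mem_stableSets.2 ⟨fun X hX => (hS' X hX).1, fun X hX Y hY hXY =>
    hcol X Y hXY ((hS' X hX).2.trans (hS' Y hY).2.symm)⟩

/-- The sum of the elements of a set modulo `n` is a proper colouring of the Johnson graph. -/
lemma exists_colouring (n : ℕ) [NeZero n] :
    ∃ col : Finset (Fin n) → ZMod n, ∀ X Y, Adj X Y → col X ≠ col Y := by
  refine ⟨fun X => ∑ i ∈ X, ((i : ℕ) : ZMod n), ?_⟩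
  rintro X _ ⟨p, hp, w, hw, rfl⟩ h
  simp only at h
  rw [sum_insert (by simp [hw]), ← add_sum_erase X _ hp, add_left_inj,
    ZMod.natCast_eq_natCast_iff] at h
  have := h.eq_of_lt_of_lt p.2 w.2
  exact hw (Fin.ext this ▸ hp)

/-! ### Counting matroids with a short circuit -/

open Classical in
/-- The families of at most `m` finite sets. -/
noncomputable def smallFamilies (α : Type*) [Fintype α] (m : ℕ) : Finset (Finset (Finset α)) :=
  univ.filter fun F => F.card ≤ m

open Classical in
lemma card_filter_circuit_ge {C : Finset α} {r : ℕ} (hr : C.card ≤ r) :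
    (Fintype.card α - C.card).choose (r - C.card) ≤
      ((univ.powersetCard r).filter fun X => C ⊆ X).card := by
  rw [← card_compl, ← card_powersetCard]
  refine card_le_card_of_injOn (fun T => C ∪ T) ?_ ?_
  · intro T hT
    obtain ⟨hT1, hT2⟩ := mem_powersetCard.1 (mem_coe.1 hT)
    refine mem_coe.2 (mem_filter.2 ⟨mem_powersetCard.2 ⟨subset_univ _, ?_⟩, subset_union_left⟩)
    rw [card_union_of_disjoint (disjoint_right.2 fun x hx => by simpa using hT1 hx)]
    omega
  · intro T hT T' hT' (h : C ∪ T = C ∪ T')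
    have key : ∀ T : Finset α, T ⊆ Cᶜ → (C ∪ T) \ C = T := fun T hT => by
      rw [union_sdiff_left, Finset.sdiff_eq_self_iff_disjoint]
      exact disjoint_left.2 fun x hxT hx => (mem_compl.1 (hT hxT)) hx
    rw [← key T (mem_powersetCard.1 (mem_coe.1 hT)).1, h,
      key T' (mem_powersetCard.1 (mem_coe.1 hT')).1]

/-- The matroids of rank `r` with a circuit whose size is between `2` and `κ`. -/
def shortCircuit (α : Type*) [DecidableEq α] (r κ : ℕ) : Set (Matroid α) :=
  {M | HasRank M r ∧ ∃ C, IsCirc M C ∧ 2 ≤ C.card ∧ C.card ≤ κ}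

/-- Count pairs (M, S) with S among the determining sets chosen for M. The code together with S
recovers M: if two matroids yield the same triple, each is compatible with the other's code, so
their nonbases contain one another. -/
theorem ncard_shortCircuit_mul_le {ι : Type*} [Fintype ι] {col : Finset α → ι}
    (hcol : ∀ X Y, Adj X Y → col X ≠ col Y) {r D d κ θ m : ℕ}
    (hp : CodeParams (Fintype.card α) r D d)
    (hcode : ∀ M : Matroid α, HasRank M r → ∀ C, IsCirc M C →
      ∃ Cs Hs, IsCode M r D d Cs Hs ∧ C ∈ Cs ∧ Cs.card ≤ m ∧ Hs.card ≤ m)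
    (hκ : κ ≤ r)
    (hθ : ∀ k ≤ κ, θ * r + Fintype.card ι * θ ≤ (Fintype.card α - k).choose (r - k)) :
    (shortCircuit α r κ).ncard * 2 ^ θ ≤ (smallFamilies α m).card ^ 2 * (stableSets α r).card := by
  classical
  have hex : ∀ M ∈ shortCircuit α r κ, ∃ Cs Hs : Finset (Finset α), ∃ 𝒮 : Finset (Finset (Finset α)),
      Compat M r Cs Hs ∧ Cs.card ≤ m ∧ Hs.card ≤ m ∧ 2 ^ θ ≤ 𝒮.card ∧
        ∀ S ∈ 𝒮, Determines M r Cs Hs S := by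
    rintro M ⟨hM, C, hC, hC2, hCκ⟩
    obtain ⟨Cs, Hs, hcd, hCCs, h1, h2⟩ := hcode M hM C hC
    obtain ⟨𝒮, h3, h4⟩ := hcd.exists_many hcol hp hCCs hC2
      ((hθ _ hCκ).trans (card_filter_circuit_ge (hCκ.trans hκ)))
    exact ⟨Cs, Hs, 𝒮, hcd.toCompat, h1, h2, h3, h4⟩
  choose! Cs Hs 𝒮 hcompat hCs hHs h𝒮 hdet using hex
  set A : Finset (Matroid α) := (Set.toFinite (shortCircuit α r κ)).toFinset with hA
  have hAm : ∀ M, M ∈ A ↔ M ∈ shortCircuit α r κ := fun M => by simp [hA]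
  have hAc : (shortCircuit α r κ).ncard = A.card := Set.ncard_eq_toFinset_card _ _
  calc (shortCircuit α r κ).ncard * 2 ^ θ = A.card • 2 ^ θ := by rw [hAc, smul_eq_mul]
    _ ≤ ∑ M ∈ A, (𝒮 M).card := card_nsmul_le_sum _ _ _ fun M hM => h𝒮 M ((hAm M).1 hM)
    _ = (A.sigma 𝒮).card := (card_sigma _ _).symm
    _ ≤ ((smallFamilies α m ×ˢ smallFamilies α m) ×ˢ stableSets α r).card := by
      refine card_le_card_of_injOn (fun x => ((Cs x.1, Hs x.1), x.2)) ?_ ?_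
      · rintro ⟨M, S⟩ hx
        obtain ⟨hM, hS⟩ := mem_sigma.1 (mem_coe.1 hx)
        have hM := (hAm M).1 hM
        have hd := hdet M hM S hS
        refine mem_coe.2 (mem_product.2 ⟨mem_product.2 ⟨?_, ?_⟩, ?_⟩)
        · exact mem_filter.2 ⟨mem_univ _, hCs M hM⟩
        · exact mem_filter.2 ⟨mem_univ _, hHs M hM⟩
        · exact mem_stableSets.2 ⟨fun X hX => (mem_nonbases.1 (hd.1 hX)).1, hd.2.1⟩
      · rintro ⟨M, S⟩ hx ⟨M', S'⟩ hx' h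
        obtain ⟨hMA, hS⟩ := mem_sigma.1 (mem_coe.1 hx)
        obtain ⟨hMA', hS'⟩ := mem_sigma.1 (mem_coe.1 hx')
        have hM := (hAm M).1 hMA
        have hM' := (hAm M').1 hMA'
        simp only [Prod.mk.injEq] at h
        obtain ⟨⟨hCe, hHe⟩, rfl⟩ := h
        have hd := hdet M hM S hS
        have hd' := hdet M' hM' S hS'
        have hc := hcompat M hM
        have hc' := hcompat M' hM'
        rw [hCe, hHe] at hd hc
        have : M = M' := hM.1.eq_of_nonbases hM'.1
          (Subset.antisymm (hd.2.2 M' hc' hd'.1) (hd'.2.2 M hc hd.1))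
        rw [this]
    _ = (smallFamilies α m).card ^ 2 * (stableSets α r).card := by
      rw [card_product, card_product, sq]

/-! ### Loops -/

lemma image_update_of_notMem {e g : α} {X : Finset α} (h : e ∉ X) :
    (Function.update id e g) '' (X : Set α) = X := by
  conv_rhs => rw [← Set.image_id (X : Set α)]
  refine Set.image_congr fun x hx => ?_
  have : x ≠ e := fun hxe => h (hxe ▸ mem_coe.1 hx)
  simp [Function.update_of_ne this]

lemma injOn_update_of_notMem {e g : α} {X : Finset α} (h : e ∉ X) :
    Set.InjOn (Function.update id e g) (X : Set α) := by
  intro x hx y hy hxy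
  have h1 : x ≠ e := fun hxe => h (hxe ▸ mem_coe.1 hx)
  have h2 : y ≠ e := fun hxe => h (hxe ▸ mem_coe.1 hy)
  simpa [Function.update_of_ne h1, Function.update_of_ne h2] using hxy

lemma ind_comap_update_iff {M : Matroid α} {e g : α} {X : Finset α} (h : e ∉ X) :
    Ind (M.comap (Function.update id e g)) X ↔ Ind M X := by
  unfold Ind
  rw [Matroid.comap_indep_iff, image_update_of_notMem h, and_iff_left (injOn_update_of_notMem h)]

/-- Pulling back along the map that sends e to g and fixes the rest turns the loop e into a parallel
copy of g, without changing the rank. -/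
lemma comap_update_mem_shortCircuit {M : Matroid α} {r κ : ℕ} (hκ : 2 ≤ κ) {e g : α}
    (hM : HasRank M r) (he : ¬ Ind M {e}) (hg : Ind M {g}) :
    M.comap (Function.update id e g) ∈ shortCircuit α r κ := by
  have hge : g ≠ e := fun h => he (h ▸ hg)
  obtain ⟨hE, B, hB, hBr⟩ := id hM
  have heB : ∀ X : Finset α, Ind M X → e ∉ X := fun X hX h => he (hX.mono (by simpa using h))
  have hcard : ∀ X : Finset α, Ind (M.comap (Function.update id e g)) X → X.card ≤ r := by
    intro X hX
    have h := Matroid.comap_indep_iff.1 hX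
    have hi : Ind M (X.image (Function.update id e g)) := by
      unfold Ind; rw [coe_image]; exact h.1
    have := hM.card_le hi
    rwa [card_image_of_injOn h.2] at this
  have hgr : (M.comap (Function.update id e g)).E = Set.univ := by
    rw [Matroid.comap_ground_eq, hE, Set.preimage_univ]
  refine ⟨⟨hgr, B, ?_, hBr⟩, {e, g}, ⟨?_, ?_⟩, ?_, ?_⟩
  · have hBi : Ind (M.comap (Function.update id e g)) B :=
      (ind_comap_update_iff (heB B hB.indep)).2 hB.indep
    refine Matroid.Indep.isBase_of_forall_insert hBi fun x hx hind => ?_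
    have hx' : x ∉ B := fun h => hx.2 (mem_coe.2 h)
    have : Ind (M.comap (Function.update id e g)) (insert x B) := by simpa [Ind] using hind
    have := hcard _ this
    rw [card_insert_of_notMem hx'] at this
    omega
  · intro h
    have := (Matroid.comap_indep_iff.1 h).2 (show e ∈ _ by simp) (show g ∈ _ by simp)
      (by simp [Function.update_of_ne hge])
    exact hge this.symm
  · intro x hx
    rcases mem_insert.1 hx with rfl | hx
    · rw [erase_insert (by simpa using hge.symm)]
      exact (ind_comap_update_iff (by simpa using hge.symm)).2 hg
    · rw [mem_singleton.1 hx]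
      have : ({e, g} : Finset α).erase g = {e} := by
        ext y; simp only [mem_erase, mem_insert, mem_singleton]
        constructor
        · rintro ⟨h1, h2 | h2⟩
          · exact h2
          · exact absurd h2 h1
        · rintro rfl
          exact ⟨hge.symm, Or.inl rfl⟩
      rw [this]
      refine Matroid.comap_indep_iff.2 ⟨?_, by simp⟩
      simpa [Ind] using hg
  · rw [card_pair hge.symm]
  · rwa [card_pair hge.symm]

/-- Once e is known to be a loop, M is determined by its independent sets avoiding e, and the
pullback does not change these. -/
lemma comap_update_injOn (e g : α) : Set.InjOn
    (fun M : Matroid α => M.comap (Function.update id e g)) {M | M.E = Set.univ ∧ ¬ Ind M {e}} := by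
  classical
  intro M hM M' hM' h
  refine Matroid.ext_indep (hM.1.trans hM'.1.symm) fun I _ => ?_
  obtain ⟨X, rfl⟩ : ∃ X : Finset α, (X : Set α) = I := ⟨I.toFinset, by simp⟩
  change Ind M X ↔ Ind M' X
  by_cases he : e ∈ X
  · exact iff_of_false (fun h => hM.2 (h.mono (by simpa using he)))
      (fun h => hM'.2 (h.mono (by simpa using he)))
  · rw [← ind_comap_update_iff (M := M) (g := g) he, ← ind_comap_update_iff (M := M') (g := g) he]
    simp only at h
    rw [h]

/-- The matroids of rank `r` with a circuit of size at most `κ`. -/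
theorem ncard_circuit_le {r κ : ℕ} (hr : 0 < r) (hκ : 2 ≤ κ) :
    {M : Matroid α | HasRank M r ∧ ∃ C, IsCirc M C ∧ C.card ≤ κ}.ncard ≤
      (Fintype.card α ^ 2 + 1) * (shortCircuit α r κ).ncard := by
  classical
  set L : α × α → Set (Matroid α) := fun p =>
    {M | HasRank M r ∧ ¬ Ind M {p.1} ∧ Ind M {p.2}} with hL
  have hLc : ∀ p, (L p).ncard ≤ (shortCircuit α r κ).ncard := fun p =>
    Set.ncard_le_ncard_of_injOn _ (fun M hM => comap_update_mem_shortCircuit hκ hM.1 hM.2.1 hM.2.2)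
      ((comap_update_injOn p.1 p.2).mono
        fun M (hM : M ∈ L p) => And.intro hM.1.1 hM.2.1) (Set.toFinite _)
  have hsub : {M : Matroid α | HasRank M r ∧ ∃ C, IsCirc M C ∧ C.card ≤ κ} ⊆
      (⋃ p ∈ (univ : Finset (α × α)), L p) ∪ shortCircuit α r κ := by
    rintro M ⟨hM, C, hC, hCκ⟩
    rcases Nat.lt_or_ge C.card 2 with h | h
    · left
      have hC0 : C.card ≠ 0 := fun h0 => hC.1 (by rw [card_eq_zero.1 h0]; simp [Ind])
      obtain ⟨e, rfl⟩ := card_eq_one.1 (show C.card = 1 by omega)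
      obtain ⟨hE, B, hB, hBr⟩ := id hM
      obtain ⟨g, hg⟩ := card_pos.1 (hBr ▸ hr)
      have hgi : Ind M {g} := Ind.mono (Y := B) hB.indep (by simpa using hg)
      have hML : M ∈ L (e, g) := ⟨hM, hC.1, hgi⟩
      exact Set.mem_biUnion (mem_univ (e, g)) hML
    · exact Or.inr ⟨hM, C, hC, h, hCκ⟩
  refine (Set.ncard_le_ncard hsub (Set.toFinite _)).trans ((Set.ncard_union_le _ _).trans ?_)
  have : (⋃ p ∈ (univ : Finset (α × α)), L p).ncard ≤
      ∑ p ∈ (univ : Finset (α × α)), (L p).ncard := Finset.set_ncard_biUnion_le _ _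
  have h2 : ∑ p ∈ (univ : Finset (α × α)), (L p).ncard ≤
      Fintype.card α ^ 2 * (shortCircuit α r κ).ncard := by
    refine (sum_le_card_nsmul _ _ _ fun p _ => hLc p).trans ?_
    rw [card_univ, Fintype.card_prod, smul_eq_mul, sq]
  linarith

end MatroidGirth

namespace MatroidGirth

open Finset

/-! ### Estimates -/

/-- Weight each family F by x^|F|; the total weight is (1 + x)^(2^n). -/
lemma card_smallFamilies_le (α : Type*) [Fintype α] (m : ℕ) {x : ℝ} (hx0 : 0 < x) (hx1 : x ≤ 1) :
    ((smallFamilies α m).card : ℝ) * x ^ m ≤ Real.exp (x * 2 ^ Fintype.card α) := by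
  classical
  have h1 : ∑ F : Finset (Finset α), x ^ F.card = (x + 1) ^ (2 ^ Fintype.card α) := by
    have := sum_pow_mul_eq_add_pow x 1 (univ : Finset (Finset α))
    rw [card_univ, Fintype.card_finset] at this
    rw [← this]
    simp
  calc ((smallFamilies α m).card : ℝ) * x ^ m = ∑ F ∈ smallFamilies α m, x ^ m := by
        rw [sum_const, nsmul_eq_mul]
    _ ≤ ∑ F ∈ smallFamilies α m, x ^ F.card :=
        sum_le_sum fun F hF => pow_le_pow_of_le_one hx0.le hx1 (mem_filter.1 hF).2
    _ ≤ ∑ F : Finset (Finset α), x ^ F.card :=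
        sum_le_sum_of_subset_of_nonneg (subset_univ _) fun _ _ _ => by positivity
    _ = (x + 1) ^ (2 ^ Fintype.card α) := h1
    _ ≤ (Real.exp x) ^ (2 ^ Fintype.card α) := by
        gcongr
        exact Real.add_one_le_exp x
    _ = Real.exp (x * 2 ^ Fintype.card α) := by
        rw [← Real.exp_nat_mul]; push_cast; ring_nf

/-- A Chernoff bound: isolate one term of (e^(-2η) + e^(2η))^n and use cosh t ≤ e^(t²/2). -/
lemma choose_le_of_le {n r : ℕ} {η : ℝ} (hη : 0 ≤ η) (hr : r ≤ n) (h : (r : ℝ) ≤ (1 / 2 - η) * n) :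
    (n.choose r : ℝ) ≤ 2 ^ n * Real.exp (-(2 * η ^ 2) * n) := by
  have h1 : (n.choose r : ℝ) * Real.exp (2 * η * (n - 2 * r)) ≤ (2 * Real.cosh (2 * η)) ^ n := by
    have hc : 2 * Real.cosh (2 * η) = Real.exp (-(2 * η)) + Real.exp (2 * η) := by
      rw [Real.cosh_eq]; ring
    rw [hc, add_pow]
    have hterm : (n.choose r : ℝ) * Real.exp (2 * η * (n - 2 * r)) =
        Real.exp (-(2 * η)) ^ r * Real.exp (2 * η) ^ (n - r) * (n.choose r) := by
      rw [← Real.exp_nat_mul, ← Real.exp_nat_mul, ← Real.exp_add, Nat.cast_sub hr, mul_comm]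
      congr 2
      ring
    rw [hterm]
    exact single_le_sum (f := fun m => Real.exp (-(2 * η)) ^ m * Real.exp (2 * η) ^ (n - m) *
      (n.choose m : ℝ)) (fun i _ => by positivity) (mem_range.2 (by omega))
  have h2 : (2 * Real.cosh (2 * η)) ^ n ≤ 2 ^ n * Real.exp (2 * η ^ 2 * n) := by
    rw [mul_pow]
    gcongr
    calc Real.cosh (2 * η) ^ n ≤ Real.exp ((2 * η) ^ 2 / 2) ^ n := by
          gcongr
          exact Real.cosh_le_exp_half_sq _
      _ = Real.exp (2 * η ^ 2 * n) := by rw [← Real.exp_nat_mul]; ring_nf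
  have h3 : Real.exp (4 * η ^ 2 * n) ≤ Real.exp (2 * η * (n - 2 * r)) := by
    have h : 2 * η * n ≤ n - 2 * r := by linarith
    refine Real.exp_le_exp.2 ?_
    calc 4 * η ^ 2 * n = 2 * η * (2 * η * n) := by ring
      _ ≤ 2 * η * (n - 2 * r) := by gcongr
  have h4 : (n.choose r : ℝ) * Real.exp (4 * η ^ 2 * n) ≤ 2 ^ n * Real.exp (2 * η ^ 2 * n) :=
    (by gcongr : _ ≤ (n.choose r : ℝ) * Real.exp (2 * η * (n - 2 * r))).trans (h1.trans h2)
  have h5 : (n.choose r : ℝ) = n.choose r * Real.exp (4 * η ^ 2 * n) * Real.exp (-(4 * η ^ 2 * n)) := by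
    rw [mul_assoc, ← Real.exp_add, add_neg_cancel, Real.exp_zero, mul_one]
  rw [h5]
  calc _ ≤ 2 ^ n * Real.exp (2 * η ^ 2 * n) * Real.exp (-(4 * η ^ 2 * n)) := by gcongr
    _ = 2 ^ n * Real.exp (-(2 * η ^ 2) * n) := by
      rw [mul_assoc, ← Real.exp_add]; ring_nf

lemma choose_le_of_far {n r : ℕ} {η : ℝ} (hη : 0 ≤ η) (hr : r ≤ n)
    (h : (r : ℝ) < (1 / 2 - η) * n ∨ (1 / 2 + η) * n < r) :
    (n.choose r : ℝ) ≤ 2 ^ n * Real.exp (-(2 * η ^ 2) * n) := by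
  rcases h with h | h
  · exact choose_le_of_le hη hr h.le
  · rw [← Nat.choose_symm hr]
    refine choose_le_of_le hη (Nat.sub_le _ _) ?_
    rw [Nat.cast_sub hr]
    linarith

/-- Each step from (n - i, r - i) to (n - i - 1, r - i - 1) costs the ratio (n - i)/(r - i), which
is at most β. -/
lemma choose_le_pow_mul_choose {n r : ℕ} {β : ℝ} (k : ℕ) (hk : k ≤ r) (hr : r ≤ n)
    (h : (n : ℝ) ≤ β * (r - k)) (hβ1 : 1 ≤ β) :
    (n.choose r : ℝ) ≤ β ^ k * (n - k).choose (r - k) := by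
  induction k with
  | zero => simp
  | succ k ih =>
    have hrk : (r : ℝ) - (k + 1 : ℕ) ≤ r - k := by push_cast; linarith
    refine (ih (by omega) (h.trans (by gcongr))).trans ?_
    rw [pow_succ, mul_assoc]
    gcongr
    obtain ⟨a, ha⟩ : ∃ a, n - k = a + 1 := ⟨n - k - 1, by omega⟩
    obtain ⟨b, hb⟩ : ∃ b, r - k = b + 1 := ⟨r - k - 1, by omega⟩
    have ha' : n - (k + 1) = a := by omega
    have hb' : r - (k + 1) = b := by omega
    rw [ha, hb, ha', hb']
    have hmul : ((a + 1 : ℕ) : ℝ) * a.choose b = (a + 1).choose (b + 1) * ((b + 1 : ℕ) : ℝ) := by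
      exact_mod_cast Nat.add_one_mul_choose_eq a b
    have hbr : ((b + 1 : ℕ) : ℝ) = r - k := by
      rw [← hb, Nat.cast_sub (by omega)]
    have han : ((a + 1 : ℕ) : ℝ) ≤ n := by exact_mod_cast (by omega : a + 1 ≤ n)
    have hbpos : (0 : ℝ) < ((b + 1 : ℕ) : ℝ) := by positivity
    refine le_of_mul_le_mul_right ?_ hbpos
    rw [← hmul]
    have h2 : ((a + 1 : ℕ) : ℝ) ≤ β * ((b + 1 : ℕ) : ℝ) := by
      rw [hbr]
      exact han.trans (h.trans (by gcongr))
    calc ((a + 1 : ℕ) : ℝ) * a.choose b ≤ (β * ((b + 1 : ℕ) : ℝ)) * a.choose b := by gcongr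
      _ = β * (a.choose b) * ((b + 1 : ℕ) : ℝ) := by ring

/-- The choice D ≈ n^(3/2) balances the hitting sets of size about N/D against those for the sparse
part, about (N D / n²)/n, up to logarithms. -/
lemma codeParams_of {n r : ℕ} (hn : 400 ≤ n) (hr : 2 * n ≤ 5 * r) (hr' : 5 * r ≤ 3 * n) :
    CodeParams n r (n * n.sqrt) (n / 8) := by
  have hs1 : n.sqrt * n.sqrt ≤ n := Nat.sqrt_le n
  have hs2 : 20 ≤ n.sqrt := Nat.le_sqrt.2 (by omega)
  have hsn : 20 * n.sqrt ≤ n := (Nat.mul_le_mul_right _ hs2).trans hs1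
  obtain ⟨q, hq⟩ : ∃ q, n = r + q := ⟨n - r, by omega⟩
  have hq' : n - r = q := by omega
  have key : ∀ a q : ℕ, 2 * n ≤ 5 * q → a * q < 2 * (n * n.sqrt) → a < 5 * n.sqrt := by
    intro a q hq h
    by_contra! hcon
    have h1 : 5 * n.sqrt * (2 * n) ≤ a * (5 * q) := Nat.mul_le_mul hcon hq
    nlinarith
  refine ⟨?_, fun a ha => ?_, fun b hb => ?_⟩
  · rw [hq']
    have h1 : (2 * n) * (2 * n) ≤ (5 * r) * (5 * q) := Nat.mul_le_mul hr (by omega)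
    have h2 : n * (20 * n.sqrt) ≤ n * n := Nat.mul_le_mul_left _ hsn
    nlinarith
  · have := key a (n - r) (by omega) ha
    omega
  · have := key b r hr (by rwa [mul_comm])
    omega

lemma hitBound_total_le {n r s : ℕ} (hn : 400 ≤ n) (hr : 2 * n ≤ 5 * r) (hr' : 5 * r ≤ 3 * n)
    (hs : s * r ^ 2 ≤ n.choose (r - 1) * (r + n * n.sqrt)) (hN : (n : ℝ) ^ 2 ≤ n.choose r) :
    1 + (3 * hitBound (n.choose r) (n.choose r) ((n * n.sqrt : ℕ) : ℝ) (2 * Real.log n) +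
      hitBound s (n.choose r) ((n / 8 : ℕ) : ℝ) (2 * Real.log n)) ≤
      250 * n.choose r * Real.log n / (n * √n) := by
  set N : ℝ := (n.choose r : ℝ) with hNdef
  have hn0 : (400 : ℝ) ≤ n := by exact_mod_cast hn
  have hnpos : (0 : ℝ) < n := by linarith
  have hs2 : √(n : ℝ) * √n = n := Real.mul_self_sqrt hnpos.le
  have hs20 : 20 ≤ √(n : ℝ) := Real.le_sqrt_of_sq_le (by norm_num; exact hn)
  have hspos : 0 < √(n : ℝ) := by linarith
  have hlog : 1 ≤ Real.log n := by
    rw [Real.le_log_iff_exp_le hnpos]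
    have := Real.exp_one_lt_d9
    linarith
  have hNpos : 0 < N := lt_of_lt_of_le (by positivity) hN
  -- With L = 2 log n the leftover of the greedy procedure is at most N/n², below the main term W
  -- introduced next.
  have hexp : Real.exp (-(2 * Real.log n)) = 1 / n ^ 2 := by
    rw [Real.exp_neg, two_mul, Real.exp_add, Real.exp_log hnpos, one_div, sq]
  have hsq1 : √(n : ℝ) / 2 ≤ (n.sqrt : ℝ) := by
    have h1 : √(n : ℝ) < n.sqrt + 1 := by
      rw [Real.sqrt_lt' (by positivity)]
      have := Nat.lt_succ_sqrt n
      have : ((n : ℕ) : ℝ) < ((n.sqrt + 1) * (n.sqrt + 1) : ℕ) := by exact_mod_cast this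
      push_cast at this
      linarith
    linarith
  have hsq2 : (n.sqrt : ℝ) ≤ √(n : ℝ) := Real.nat_sqrt_le_real_sqrt
  set W : ℝ := N * Real.log n / (n * √n) with hW
  have hWN : N / n ^ 2 ≤ W := by
    rw [hW, div_le_div_iff₀ (by positivity) (by positivity)]
    have : √(n : ℝ) ≤ n := by nlinarith
    have h1 : N * (n * √n) ≤ N * (n * n) := by gcongr
    have h2 : N * (n * n) * 1 ≤ N * (n * n) * Real.log n := by gcongr
    nlinarith
  have h1N : 1 ≤ N / n ^ 2 := by rwa [one_le_div (by positivity)]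
  have hA : N / ((n * n.sqrt : ℕ) : ℝ) * (2 * Real.log n) ≤ 4 * W := by
    have hden : n * √(n : ℝ) / 2 ≤ ((n * n.sqrt : ℕ) : ℝ) := by
      push_cast
      nlinarith
    calc N / ((n * n.sqrt : ℕ) : ℝ) * (2 * Real.log n) ≤ N / (n * √(n : ℝ) / 2) * (2 * Real.log n) := by
          gcongr
      _ = 4 * W := by rw [hW]; field_simp; ring
  have hrR : 2 * (n : ℝ) ≤ 5 * r := by exact_mod_cast hr
  have hrR' : 5 * (r : ℝ) ≤ 3 * n := by exact_mod_cast hr'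
  have hrpos : (0 : ℝ) < r := by linarith
  have hsR : (s : ℝ) ≤ 25 / 2 * N / √n := by
    have h1 : (n.choose (r - 1) : ℝ) * (n - r + 1) = N * r := by
      obtain ⟨t, rfl⟩ : ∃ t, r = t + 1 := ⟨r - 1, by omega⟩
      have := Nat.choose_succ_right_eq n t
      have h2 : ((n - t : ℕ) : ℝ) = n - t := Nat.cast_sub (by omega)
      rw [hNdef, Nat.add_sub_cancel]
      have : ((n.choose (t + 1) * (t + 1) : ℕ) : ℝ) = ((n.choose t * (n - t) : ℕ) : ℝ) := by
        rw [this]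
      push_cast [h2] at this ⊢
      linarith
    have h2 : (s : ℝ) * r ^ 2 ≤ n.choose (r - 1) * (r + n * n.sqrt) := by exact_mod_cast hs
    have hq : 2 / 5 * (n : ℝ) ≤ n - r + 1 := by linarith
    have h3 : (r : ℝ) + n * n.sqrt ≤ 2 * (n * √n) := by nlinarith
    have h4 : (n.choose (r - 1) : ℝ) * (2 / 5 * n) ≤ N * r := by
      rw [← h1]; gcongr
    have h5 : (s : ℝ) * r ^ 2 * (2 / 5 * n) ≤ (N * r) * (2 * (n * √n)) := by
      calc (s : ℝ) * r ^ 2 * (2 / 5 * n) ≤ n.choose (r - 1) * (r + n * n.sqrt) * (2 / 5 * n) := by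
            gcongr
        _ = (n.choose (r - 1) * (2 / 5 * n)) * (r + n * n.sqrt) := by ring
        _ ≤ (N * r) * (2 * (n * √n)) := by gcongr
    have h6 : (s : ℝ) * r ≤ 5 * N * √n := by
      have hc : (0 : ℝ) < r * (2 / 5 * n) := by positivity
      refine le_of_mul_le_mul_right ?_ hc
      nlinarith
    have h7 : (s : ℝ) * (2 / 5 * n) ≤ 5 * N * √n := by
      refine le_trans ?_ h6
      gcongr
      linarith
    rw [le_div_iff₀ hspos]
    have h8 : (s : ℝ) * (2 / 5 * (√n * √n)) ≤ 5 * N * √n := by rw [hs2]; exact h7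
    have h9 : (s : ℝ) * √n * (2 / 5) ≤ 5 * N := by
      refine le_of_mul_le_mul_right ?_ hspos
      nlinarith
    linarith
  have hd : (n : ℝ) / 9 ≤ ((n / 8 : ℕ) : ℝ) := by
    have h1 : n ≤ 9 * (n / 8) := by omega
    have : (n : ℝ) ≤ 9 * ((n / 8 : ℕ) : ℝ) := by exact_mod_cast h1
    linarith
  have hB : (s : ℝ) / ((n / 8 : ℕ) : ℝ) * (2 * Real.log n) ≤ 225 * W := by
    calc (s : ℝ) / ((n / 8 : ℕ) : ℝ) * (2 * Real.log n)
        ≤ (25 / 2 * N / √n) / (n / 9) * (2 * Real.log n) := by gcongr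
      _ = 225 * W := by rw [hW]; field_simp; ring
  have hWe : 250 * N * Real.log n / (n * √n) = 250 * W := by rw [hW]; ring
  rw [hWe]
  unfold hitBound
  rw [hexp]
  have : N * (1 / (n : ℝ) ^ 2) = N / n ^ 2 := by ring
  rw [this]
  linarith

end MatroidGirth

namespace MatroidGirth

open Finset

/-! ### Asymptotics -/

lemma eventually_pow_le_two_pow (k : ℕ) (C : ℝ) : ∀ᶠ n : ℕ in atTop, C * (n : ℝ) ^ k ≤ 2 ^ n := by
  have h := tendsto_pow_const_div_const_pow_of_one_lt k (r := (2 : ℝ)) (by norm_num)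
  have h' := (h.const_mul C).eventually_le_const (u := 1) (by simp)
  filter_upwards [h'] with n hn
  rw [← mul_div_assoc, div_le_one (by positivity)] at hn
  exact hn

lemma eventually_mul_pow_exp_lt (k : ℕ) {b : ℝ} (hb : 0 < b) :
    ∀ᶠ n : ℕ in atTop, (n : ℝ) ^ k * Real.exp (-b * n) < 1 := by
  have h := tendsto_pow_const_mul_const_pow_of_lt_one k (r := Real.exp (-b)) (by positivity)
    (by rw [Real.exp_lt_one_iff]; linarith)
  filter_upwards [h.eventually_lt_const (u := 1) (by norm_num)] with n hn
  rw [← Real.exp_nat_mul] at hn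
  rwa [mul_comm (-b)]

lemma eventually_middle {η : ℝ} (hη : 0 < η) : ∀ᶠ n : ℕ in atTop, ∀ r : ℕ,
    (2 : ℝ) ^ n / n ^ 3 ≤ n.choose r →
      r ≤ n ∧ (1 / 2 - η) * n ≤ r ∧ (r : ℝ) ≤ (1 / 2 + η) * n := by
  filter_upwards [eventually_mul_pow_exp_lt 3 (b := 2 * η ^ 2) (by positivity),
    eventually_gt_atTop 0] with n hn hpos r hr
  have hn0 : (0 : ℝ) < n := by exact_mod_cast hpos
  have hrn : r ≤ n := by
    by_contra! h
    rw [Nat.choose_eq_zero_of_lt h] at hr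
    have : (0 : ℝ) < 2 ^ n / n ^ 3 := by positivity
    simp only [Nat.cast_zero] at hr
    linarith
  refine ⟨hrn, ?_⟩
  by_contra hcon
  have hfar : (r : ℝ) < (1 / 2 - η) * n ∨ (1 / 2 + η) * n < r := by
    by_contra! h
    exact hcon h
  have h1 := hr.trans (choose_le_of_far hη.le hrn hfar)
  rw [div_le_iff₀ (by positivity)] at h1
  have h2 : (2 : ℝ) ^ n * ((n : ℝ) ^ 3 * Real.exp (-(2 * η ^ 2) * n)) < 2 ^ n * 1 := by gcongr
  linarith

/-- Up to constants, the right side is N / n^(1+u) and the main cost on the left is N log² n /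
n^(3/2); this is where u < 1/2 enters. The term 2^n / n^5 is at most N / n². -/
lemma eventually_numeric {u : ℝ} (hu : u < 1 / 2) : ∀ᶠ n : ℕ in atTop,
    ∀ N : ℝ, (2 : ℝ) ^ n / n ^ 3 ≤ N →
      2 * (2 ^ n / (n : ℝ) ^ 5) + 2500 * N * Real.log n ^ 2 / (n * √n) + n + 1 ≤
        N / (8 * n * (n : ℝ) ^ u) := by
  have hlog : ∀ᶠ n : ℕ in atTop, 2500 * Real.log n ^ 2 * (n : ℝ) ^ u / √n ≤ 1 / 40 := by
    have h := (isLittleO_log_rpow_rpow_atTop (s := 1 / 2 - u) 2 (by linarith)).tendsto_div_nhds_zero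
    have h' := (h.comp tendsto_natCast_atTop_atTop).const_mul 2500
    filter_upwards [h'.eventually_le_const (u := 1 / 40) (by norm_num),
      eventually_gt_atTop 0] with n hn hpos
    have hn0 : (0 : ℝ) < n := by exact_mod_cast hpos
    simp only [Function.comp] at hn
    rw [Real.rpow_sub hn0, ← Real.sqrt_eq_rpow, Real.rpow_two] at hn
    have : 2500 * Real.log n ^ 2 * (n : ℝ) ^ u / √n =
        2500 * (Real.log n ^ 2 / (√n / (n : ℝ) ^ u)) := by
      have := Real.rpow_pos_of_pos hn0 u
      have := Real.sqrt_pos.2 hn0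
      field_simp
    rwa [this]
  filter_upwards [hlog, eventually_pow_le_two_pow 6 80, eventually_ge_atTop 6400] with n h1 h2 h3 N hN
  have hn : (6400 : ℝ) ≤ n := by exact_mod_cast h3
  have hn0 : (0 : ℝ) < n := by linarith
  have hs2 : √(n : ℝ) * √n = n := Real.mul_self_sqrt hn0.le
  have hs80 : 80 ≤ √(n : ℝ) := Real.le_sqrt_of_sq_le (by linarith)
  have hspos : 0 < √(n : ℝ) := by linarith
  have hupos := Real.rpow_pos_of_pos hn0 u
  have hule : (n : ℝ) ^ u ≤ √n := by
    rw [Real.sqrt_eq_rpow]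
    exact Real.rpow_le_rpow_of_exponent_le (by linarith) hu.le
  set v := (n : ℝ) ^ u with hv
  have hNpos : 0 < N := lt_of_lt_of_le (by positivity) hN
  have hNn : (2 : ℝ) ^ n ≤ N * n ^ 3 := by rwa [div_le_iff₀ (by positivity)] at hN
  have hden : 0 < (n : ℝ) * v := by positivity
  have e1 : 2 * (2 ^ n / (n : ℝ) ^ 5) ≤ N / (n * v) * (1 / 40) := by
    have : 2 * (2 ^ n / (n : ℝ) ^ 5) ≤ 2 * N / n ^ 2 := by
      rw [← mul_div_assoc, div_le_div_iff₀ (by positivity) (by positivity)]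
      have := mul_le_mul_of_nonneg_right hNn (show (0 : ℝ) ≤ n ^ 2 by positivity)
      nlinarith
    refine this.trans ?_
    rw [div_mul_div_comm, div_le_div_iff₀ (by positivity) (by positivity)]
    have h80 : 80 * v ≤ n := by nlinarith
    have : N * n * (80 * v) ≤ N * n * n := by gcongr
    nlinarith
  have e2 : 2500 * N * Real.log n ^ 2 / (n * √n) ≤ N / (n * v) * (1 / 40) := by
    have : 2500 * N * Real.log n ^ 2 / (n * √n) =
        N / (n * v) * (2500 * Real.log n ^ 2 * v / √n) := by field_simp
    rw [this]
    gcongr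
  have e3 : (n : ℝ) + 1 ≤ N / (n * v) * (1 / 40) := by
    rw [div_mul_div_comm, le_div_iff₀ (by positivity)]
    have hvn : v ≤ n := by nlinarith
    have hN2 : 80 * (n : ℝ) ^ 3 ≤ N := by
      have : 80 * (n : ℝ) ^ 3 * n ^ 3 ≤ N * n ^ 3 := by
        calc 80 * (n : ℝ) ^ 3 * n ^ 3 = 80 * n ^ 6 := by ring
          _ ≤ 2 ^ n := h2
          _ ≤ _ := hNn
      exact le_of_mul_le_mul_right this (by positivity)
    have : ((n : ℝ) + 1) * (n * v * 40) ≤ (2 * n) * (n * n * 40) := by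
      gcongr
      linarith
    nlinarith
  have e4 : N / (8 * n * v) = N / (n * v) * (1 / 8) := by field_simp
  rw [e4]
  have : 0 ≤ N / (n * v) := by positivity
  linarith

end MatroidGirth

/-! ### Comparing the number of codes with the number of stable sets -/

namespace MatroidGirth

open Finset

lemma smallFamilies_sq_mul_le {n m θ : ℕ} {N u : ℝ} (hn : 400 ≤ n)
    (hm : (m : ℝ) ≤ 250 * N * Real.log n / (n * √n))
    (hθ : N / (4 * n * (n : ℝ) ^ u) - 1 ≤ θ)
    (h : 2 * (2 ^ n / (n : ℝ) ^ 5) + 2500 * N * Real.log n ^ 2 / (n * √n) + n + 1 ≤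
        N / (8 * n * (n : ℝ) ^ u)) :
    (smallFamilies (Fin n) m).card ^ 2 * 2 ^ n ≤ 2 ^ θ := by
  have hn0 : (400 : ℝ) ≤ n := by exact_mod_cast hn
  have hnpos : (0 : ℝ) < n := by linarith
  have hlog : 0 ≤ Real.log n := Real.log_nonneg (by linarith)
  have hF : ((smallFamilies (Fin n) m).card : ℝ) ≤
      Real.exp (2 ^ n / (n : ℝ) ^ 5 + m * (5 * Real.log n)) := by
    -- The exponent 5 makes 2^n / n^5 negligible against N / n^(1+u) when N ≥ 2^n / n^3, at the
    -- price of only 5 m log n in the exponent.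
    have h1 := card_smallFamilies_le (Fin n) m (x := 1 / (n : ℝ) ^ 5) (by positivity)
      (by rw [div_le_one (by positivity)]; exact one_le_pow₀ (by linarith))
    rw [Fintype.card_fin, div_pow, one_pow, mul_one_div, div_le_iff₀ (by positivity)] at h1
    have h2 : ((n : ℝ) ^ 5) ^ m = Real.exp (m * (5 * Real.log n)) := by
      rw [Real.exp_nat_mul]
      congr 1
      have : (5 : ℝ) * Real.log n = (5 : ℕ) * Real.log n := by norm_num
      rw [this, Real.exp_nat_mul, Real.exp_log hnpos]
    rw [h2] at h1
    rw [Real.exp_add]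
    refine h1.trans (le_of_eq ?_)
    congr 2
    ring
  have hmlog : m * Real.log n ≤ 250 * N * Real.log n ^ 2 / (n * √n) := by
    calc m * Real.log n ≤ (250 * N * Real.log n / (n * √n)) * Real.log n := by gcongr
      _ = _ := by ring
  have hl2 : Real.log 2 ≤ 1 := by have := Real.log_two_lt_d9; linarith
  have hl2' : 1 / 2 ≤ Real.log 2 := by have := Real.log_two_gt_d9; linarith
  have htwo : ∀ k : ℕ, (2 : ℝ) ^ k = Real.exp (k * Real.log 2) := fun k => by
    rw [Real.exp_nat_mul, Real.exp_log (by norm_num)]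
  have hreal : ((smallFamilies (Fin n) m).card : ℝ) ^ 2 * 2 ^ n ≤ 2 ^ θ := by
    calc ((smallFamilies (Fin n) m).card : ℝ) ^ 2 * 2 ^ n
        ≤ Real.exp (2 ^ n / (n : ℝ) ^ 5 + m * (5 * Real.log n)) ^ 2 * 2 ^ n := by gcongr
      _ = Real.exp (2 * (2 ^ n / (n : ℝ) ^ 5 + m * (5 * Real.log n)) + n * Real.log 2) := by
          generalize (2 : ℝ) ^ n / (n : ℝ) ^ 5 + m * (5 * Real.log n) = A
          rw [Real.exp_add (2 * A), ← htwo n, two_mul A, Real.exp_add A A]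
          ring
      _ ≤ Real.exp (θ * Real.log 2) := by
          refine Real.exp_le_exp.2 ?_
          have e1 : (n : ℝ) * Real.log 2 ≤ n := by nlinarith
          have e3 : 2500 * N * Real.log n ^ 2 / (n * √n) =
            10 * (250 * N * Real.log n ^ 2 / (n * √n)) := by ring
          have e4 : N / (4 * n * (n : ℝ) ^ u) = 2 * (N / (8 * n * (n : ℝ) ^ u)) := by
            have := Real.rpow_pos_of_pos hnpos u
            field_simp
            ring
          set Z := N / (8 * n * (n : ℝ) ^ u)
          have hZ : 0 ≤ Z := by
            have h5 : (0 : ℝ) ≤ 2 ^ n / (n : ℝ) ^ 5 := by positivity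
            have h6 : 0 ≤ m * Real.log n := by positivity
            linarith
          have e5 : Z - 1 ≤ θ * Real.log 2 := by
            rcases le_total (2 * Z - 1) 0 with h0 | h0
            · have : 0 ≤ θ * Real.log 2 := by positivity
              linarith
            · have : (2 * Z - 1) * (1 / 2) ≤ θ * Real.log 2 := by
                rw [e4] at hθ
                gcongr
              linarith
          linarith
      _ = 2 ^ θ := (htwo θ).symm
  exact_mod_cast hreal

theorem eventually_shortCircuit_le {c : ℝ} (hc0 : 0 < c) (hc : c < 1 / 2) :
    ∀ᶠ n : ℕ in atTop, ∀ r κ : ℕ, (κ : ℝ) ≤ c * Real.logb 2 n →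
      (2 : ℝ) ^ n / n ^ 3 ≤ n.choose r → 0 < r ∧ r < n ∧
        (shortCircuit (Fin n) r κ).ncard * 2 ^ n ≤ (stableSets (Fin n) r).card := by
  -- The gap between c and u pays for β exceeding 2: β^κ ≤ n^u when κ ≤ c log₂ n. As β > 2, there is
  -- room for r to deviate from n/2 and for κ to be subtracted from r, by ηn each.
  set u : ℝ := (c + 1 / 2) / 2 with hu
  have hcu : c < u := by rw [hu]; linarith
  have hu2 : u < 1 / 2 := by rw [hu]; linarith
  set β : ℝ := (2 : ℝ) ^ (u / c) with hβ
  have hβ2 : 2 < β := by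
    rw [hβ]
    conv_lhs => rw [← Real.rpow_one 2]
    exact Real.rpow_lt_rpow_of_exponent_lt (by norm_num) ((one_lt_div hc0).2 hcu)
  set η : ℝ := min ((1 / 2 - 1 / β) / 2) (1 / 10) with hη
  have hβinv : 1 / β < 1 / 2 := one_div_lt_one_div_of_lt (by norm_num) hβ2
  have hηpos : 0 < η := lt_min (by linarith) (by norm_num)
  have hη1 : η ≤ (1 / 2 - 1 / β) / 2 := min_le_left _ _
  have hη2 : η ≤ 1 / 10 := min_le_right _ _
  have hlogn : ∀ᶠ n : ℕ in atTop, c * Real.logb 2 n ≤ η * n := by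
    have h := (Real.isLittleO_log_id_atTop.tendsto_div_nhds_zero.comp
      tendsto_natCast_atTop_atTop).const_mul (c / Real.log 2)
    filter_upwards [h.eventually_le_const (u := η) (by simpa using hηpos),
      eventually_gt_atTop 0] with n hn hpos
    have hn0 : (0 : ℝ) < n := by exact_mod_cast hpos
    simp only [Function.comp, id] at hn
    rw [← mul_div_assoc, div_le_iff₀ hn0] at hn
    calc c * Real.logb 2 n = c / Real.log 2 * Real.log n := by rw [Real.logb]; ring
      _ ≤ η * n := hn
  filter_upwards [hlogn, eventually_middle hηpos, eventually_numeric hu2,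
    eventually_pow_le_two_pow 5 1, eventually_ge_atTop 400] with n h1 h2 h3 h4 h5 r κ hκ hN
  obtain ⟨hrn, hr1, hr2⟩ := h2 r hN
  have hn0 : (400 : ℝ) ≤ n := by exact_mod_cast h5
  have hnpos : (0 : ℝ) < n := by linarith
  have : NeZero n := ⟨by omega⟩
  have hr1' : 2 * n ≤ 5 * r := by
    have : (2 : ℝ) * n ≤ 5 * r := by nlinarith
    exact_mod_cast this
  have hr2' : 5 * r ≤ 3 * n := by
    have : (5 : ℝ) * r ≤ 3 * n := by nlinarith
    exact_mod_cast this
  refine ⟨by omega, by omega, ?_⟩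
  have hκη : (κ : ℝ) ≤ η * n := hκ.trans h1
  have hκr : κ ≤ r := by
    have : (κ : ℝ) ≤ r := by nlinarith
    exact_mod_cast this
  have hn_le : (n : ℝ) ≤ β * (r - κ) := by
    have h6 : 1 / β * n ≤ r - κ := by nlinarith
    have h7 : β * (1 / β * n) ≤ β * (r - κ) := by gcongr
    have h8 : β * (1 / β * n) = n := by field_simp
    linarith
  have hβκ : β ^ κ ≤ (n : ℝ) ^ u := by
    rw [hβ, ← Real.rpow_mul_natCast (by norm_num)]
    have h6 : u / c * κ ≤ Real.logb 2 n * u := by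
      calc u / c * κ ≤ u / c * (c * Real.logb 2 n) := by
            have : 0 < u := hc0.trans hcu
            gcongr
        _ = Real.logb 2 n * u := by field_simp
    refine (Real.rpow_le_rpow_of_exponent_le (by norm_num) h6).trans (le_of_eq ?_)
    rw [Real.rpow_mul (by norm_num), Real.rpow_logb (by norm_num) (by norm_num) hnpos]
  have hupos := Real.rpow_pos_of_pos hnpos u
  have hn2 : (n : ℝ) ^ 2 ≤ n.choose r := by
    refine le_trans ?_ hN
    rw [le_div_iff₀ (by positivity)]
    calc (n : ℝ) ^ 2 * n ^ 3 = 1 * n ^ 5 := by ring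
      _ ≤ 2 ^ n := h4
  obtain ⟨col, hcol⟩ := exists_colouring n
  set θ := ⌊(n.choose r : ℝ) / (4 * n * (n : ℝ) ^ u)⌋₊ with hθdef
  set m := ⌊250 * (n.choose r : ℝ) * Real.log n / (n * √n)⌋₊ with hmdef
  have hlog : 0 ≤ Real.log n := Real.log_nonneg (by linarith)
  have hm : (m : ℝ) ≤ 250 * (n.choose r : ℝ) * Real.log n / (n * √n) := Nat.floor_le (by positivity)
  have hθ : (n.choose r : ℝ) / (4 * n * (n : ℝ) ^ u) - 1 ≤ θ := (Nat.sub_one_lt_floor _).le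
  have hF := smallFamilies_sq_mul_le h5 hm hθ (h3 _ hN)
  have hmain := ncard_shortCircuit_mul_le (α := Fin n) hcol (r := r) (D := n * n.sqrt) (d := n / 8)
    (κ := κ) (θ := θ) (m := m) (by rw [Fintype.card_fin]; exact codeParams_of h5 hr1' hr2')
    (fun M hM C hC => by
      have hD : 0 < n * n.sqrt := Nat.mul_pos (by omega) (Nat.sqrt_pos.2 (by omega))
      obtain ⟨Cs, Hs, g1, g2, g3, g4⟩ := exists_isCode (r := r) (D := n * n.sqrt) (d := n / 8)
        hD (by omega) (L := 2 * Real.log n) (by positivity) hC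
      have hsp : (sparsePart M r (n * n.sqrt)).card * r ^ 2 ≤
          n.choose (r - 1) * (r + n * n.sqrt) := by
        obtain ⟨t, rfl⟩ : ∃ t, r = t + 1 := ⟨r - 1, by omega⟩
        have := card_sparsePart_mul_le M t (n * n.sqrt)
        rwa [Fintype.card_fin] at this
      have htot := hitBound_total_le h5 hr1' hr2' hsp hn2
      rw [Fintype.card_fin] at g3 g4
      exact ⟨Cs, Hs, g1, g2, Nat.le_floor (g3.trans htot), Nat.le_floor (g4.trans htot)⟩)
    hκr (fun k hk => by
      rw [Fintype.card_fin, ZMod.card]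
      have hkr : (k : ℝ) ≤ κ := by exact_mod_cast hk
      have h6 := choose_le_pow_mul_choose (β := β) k (hk.trans hκr) hrn
        (hn_le.trans (by gcongr)) (by linarith)
      have h7 : β ^ k ≤ (n : ℝ) ^ u :=
        (pow_le_pow_right₀ (by linarith) hk).trans hβκ
      have h8 : (n.choose r : ℝ) ≤ (n : ℝ) ^ u * (n - k).choose (r - k) :=
        h6.trans (by gcongr)
      have h9 : (θ : ℝ) ≤ (n.choose r : ℝ) / (4 * n * (n : ℝ) ^ u) := Nat.floor_le (by positivity)
      have h10 : (θ : ℝ) * (4 * n) ≤ (n - k).choose (r - k) := by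
        rw [le_div_iff₀ (by positivity)] at h9
        refine le_of_mul_le_mul_right ?_ hupos
        linarith
      have h11 : θ * (4 * n) ≤ (n - k).choose (r - k) := by exact_mod_cast h10
      have h12 : θ * r ≤ θ * n := Nat.mul_le_mul_left _ hrn
      nlinarith)
  have hFpos : 0 < (smallFamilies (Fin n) m).card ^ 2 := by
    refine pow_pos (card_pos.2 ⟨∅, ?_⟩) 2
    simp [smallFamilies]
  refine Nat.le_of_mul_le_mul_left ?_ hFpos
  calc (smallFamilies (Fin n) m).card ^ 2 * ((shortCircuit (Fin n) r κ).ncard * 2 ^ n)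
      = (shortCircuit (Fin n) r κ).ncard * ((smallFamilies (Fin n) m).card ^ 2 * 2 ^ n) := by ring
    _ ≤ (shortCircuit (Fin n) r κ).ncard * 2 ^ θ := Nat.mul_le_mul_left _ hF
    _ ≤ _ := hmain

/-! ### The main theorem -/

lemma exists_isCirc_of_girth {n : ℕ} {M : Matroid (Fin n)} {x : ℝ}
    (h : ¬ ((x : ℝ) : EReal) ≤ ((M.girth : ENNReal) : EReal)) :
    ∃ C : Finset (Fin n), IsCirc M C ∧ (C.card : ℝ) ≤ x := by
  classical
  by_contra! hcon
  refine h ?_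
  have hq : ((⌈x⌉₊ : ℕ) : ℕ∞) ≤ M.girth := by
    refine le_iInf fun C => le_iInf fun hC => ?_
    obtain ⟨X, rfl⟩ : ∃ X : Finset (Fin n), (X : Set (Fin n)) = C := ⟨C.toFinset, by simp⟩
    have hX : IsCirc M X := ⟨hC.not_indep, fun e he => by
      have := hC.sdiff_singleton_indep (mem_coe.2 he)
      unfold Ind
      rwa [coe_erase]⟩
    rw [Set.encard_coe_eq_coe_finsetCard]
    exact_mod_cast Nat.ceil_le.2 (hcon X hX).le
  have h1 : ((x : ℝ) : EReal) ≤ ((⌈x⌉₊ : ℝ) : EReal) := EReal.coe_le_coe_iff.2 (Nat.le_ceil x)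
  refine h1.trans ?_
  have h2 : (((⌈x⌉₊ : ℕ) : ENNReal) : EReal) ≤ ((M.girth : ENNReal) : EReal) := by
    rw [EReal.coe_ennreal_le_coe_ennreal_iff]
    exact_mod_cast hq
  refine le_trans (le_of_eq ?_) h2
  rw [← ENNReal.ofReal_natCast, EReal.coe_ennreal_ofReal, max_eq_left (Nat.cast_nonneg _)]

lemma ncard_hasRank_le_matroidsOn (n r : ℕ) :
    {M : Matroid (Fin n) | HasRank M r}.ncard ≤ (matroidsOn n).ncard :=
  Set.ncard_le_ncard (fun _ hM => hM.1) (matroidsOn_finite n)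

/-- The middle rank alone has at least 2^(middle binomial / n) sparse paving matroids, from
subfamilies of one colour class. This exponent is at least of order 2^n / n², which beats 2^n / n^3.
-/
lemma eventually_two_pow_le_matroidsOn : ∀ᶠ n : ℕ in atTop, ∀ r : ℕ,
    (n.choose r : ℝ) < 2 ^ n / n ^ 3 → 2 ^ n.choose r * 2 ^ n ≤ (matroidsOn n).ncard := by
  filter_upwards [eventually_pow_le_two_pow 4 2, eventually_ge_atTop 4] with n h1 h2 r hr
  have hn : (4 : ℝ) ≤ n := by exact_mod_cast h2
  have hn0 : (0 : ℝ) < n := by linarith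
  have : NeZero n := ⟨by omega⟩
  obtain ⟨col, hcol⟩ := exists_colouring n
  have hq := pow_le_card_stableSets hcol (r := n / 2) (q := n.choose (n / 2) / n)
    (by rw [Fintype.card_fin, ZMod.card]; exact Nat.mul_div_le _ _)
  have hs := card_stableSets_le (α := Fin n) (r := n / 2) (by omega) (by rw [Fintype.card_fin]; omega)
  rw [← pow_add]
  refine le_trans (Nat.pow_le_pow_right (by norm_num) ?_)
    (hq.trans (hs.trans (ncard_hasRank_le_matroidsOn n _)))
  rw [Nat.le_div_iff_mul_le (by omega)]
  have hmid : 2 ^ n ≤ (n + 1) * n.choose (n / 2) := by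
    rw [← Nat.sum_range_choose n, ← card_range (n + 1), ← smul_eq_mul]
    simp only [card_range]
    refine (sum_le_card_nsmul _ _ _ fun k _ => Nat.choose_le_middle k n).trans ?_
    rw [card_range]
  have hmidR : (2 : ℝ) ^ n ≤ (n + 1) * n.choose (n / 2) := by exact_mod_cast hmid
  have hgoal : ((n.choose r : ℝ) + n) * n ≤ n.choose (n / 2) := by
    have e1 : (n : ℝ) + 1 > 0 := by linarith
    refine le_of_mul_le_mul_left ?_ e1
    refine le_trans ?_ hmidR
    set P : ℝ := 2 ^ n with hP
    have e2 : (n : ℝ) ≤ P / n ^ 3 := by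
      rw [le_div_iff₀ (by positivity)]
      have e9 : (n : ℝ) * n ^ 3 = n ^ 4 := by ring
      have e8 : (0 : ℝ) ≤ n ^ 4 := by positivity
      linarith
    calc ((n : ℝ) + 1) * (((n.choose r : ℝ) + n) * n) ≤ (n + 1) * ((P / n ^ 3 + P / n ^ 3) * n) := by
          gcongr
      _ = P * ((n + 1) * 2 / n ^ 2) := by field_simp; ring
      _ ≤ P * 1 := by
          have : ((n : ℝ) + 1) * 2 / n ^ 2 ≤ 1 := by
            rw [div_le_one (by positivity)]
            nlinarith
          have hP0 : 0 ≤ P := by positivity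
          gcongr
      _ = P := mul_one P
  exact_mod_cast hgoal

theorem eventually_short_le {c : ℝ} (hc : c < 1 / 2) : ∀ᶠ n : ℕ in atTop,
    {M : Matroid (Fin n) | M ∈ matroidsOn n ∧
      ¬ ((c * Real.logb 2 (n : ℝ) : ℝ) : EReal) ≤ ((M.girth : ENNReal) : EReal)}.ncard * 2 ^ n ≤
        (n + 1) * ((n ^ 2 + 1) * (matroidsOn n).ncard) := by
  -- Raising c only strengthens the claim; positivity of `c'` and κ ≥ 2 are needed for the
  -- estimates, including the passage from loops to parallel pairs.
  set c' : ℝ := max c (1 / 4) with hc'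
  have hc'0 : 0 < c' := lt_of_lt_of_le (by norm_num) (le_max_right _ _)
  have hc'1 : c' < 1 / 2 := max_lt hc (by norm_num)
  filter_upwards [eventually_shortCircuit_le hc'0 hc'1, eventually_two_pow_le_matroidsOn,
    eventually_ge_atTop 256] with n h1 h2 h3
  have hn : (256 : ℝ) ≤ n := by exact_mod_cast h3
  have hlogb : 8 ≤ Real.logb 2 n := by
    rw [Real.le_logb_iff_rpow_le (by norm_num) (by linarith)]
    refine le_trans (le_of_eq ?_) hn
    have : (8 : ℝ) = (8 : ℕ) := by norm_num
    rw [this, Real.rpow_natCast]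
    norm_num
  set κ := ⌊c' * Real.logb 2 n⌋₊ with hκ
  have hκle : (κ : ℝ) ≤ c' * Real.logb 2 n := Nat.floor_le (by positivity)
  have hκ2 : 2 ≤ κ := by
    refine Nat.le_floor ?_
    have : (1 / 4 : ℝ) ≤ c' := le_max_right _ _
    push_cast
    nlinarith
  set B : ℕ → Set (Matroid (Fin n)) := fun r =>
    {M | HasRank M r ∧ ∃ C, IsCirc M C ∧ C.card ≤ κ} with hB
  have hBr : ∀ r, (B r).ncard * 2 ^ n ≤ (n ^ 2 + 1) * (matroidsOn n).ncard := by
    intro r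
    rcases lt_or_ge (n.choose r : ℝ) (2 ^ n / n ^ 3) with hlt | hge
    · have e1 : (B r).ncard ≤ 2 ^ n.choose r := by
        have := ncard_hasRank_le (α := Fin n) r
        rw [Fintype.card_fin] at this
        exact (Set.ncard_le_ncard (fun M hM => hM.1) (Set.toFinite _)).trans this
      calc (B r).ncard * 2 ^ n ≤ 2 ^ n.choose r * 2 ^ n := Nat.mul_le_mul_right _ e1
        _ ≤ (matroidsOn n).ncard := h2 r hlt
        _ ≤ _ := Nat.le_mul_of_pos_left _ (by positivity)
    · obtain ⟨hr0, hrn, hle⟩ := h1 r κ hκle hge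
      have e1 := ncard_circuit_le (α := Fin n) hr0 hκ2
      rw [Fintype.card_fin] at e1
      have e2 := card_stableSets_le (α := Fin n) hr0 (by rwa [Fintype.card_fin])
      calc (B r).ncard * 2 ^ n ≤ (n ^ 2 + 1) * (shortCircuit (Fin n) r κ).ncard * 2 ^ n :=
            Nat.mul_le_mul_right _ e1
        _ = (n ^ 2 + 1) * ((shortCircuit (Fin n) r κ).ncard * 2 ^ n) := by ring
        _ ≤ (n ^ 2 + 1) * (matroidsOn n).ncard := Nat.mul_le_mul_left _
            (hle.trans (e2.trans (ncard_hasRank_le_matroidsOn n r)))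
  have hsub : {M : Matroid (Fin n) | M ∈ matroidsOn n ∧
      ¬ ((c * Real.logb 2 (n : ℝ) : ℝ) : EReal) ≤ ((M.girth : ENNReal) : EReal)} ⊆
      ⋃ r ∈ range (n + 1), B r := by
    rintro M ⟨hM, hg⟩
    obtain ⟨C, hC, hCc⟩ := exists_isCirc_of_girth hg
    obtain ⟨r, hr, hMr⟩ := exists_hasRank hM
    rw [Fintype.card_fin] at hr
    have hMB : M ∈ B r := by
      refine ⟨hMr, C, hC, Nat.le_floor (hCc.trans ?_)⟩
      have : c ≤ c' := le_max_left _ _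
      gcongr
    exact Set.mem_biUnion (mem_range.2 (by omega)) hMB
  calc _ ≤ (⋃ r ∈ range (n + 1), B r).ncard * 2 ^ n :=
        Nat.mul_le_mul_right _ (Set.ncard_le_ncard hsub (Set.toFinite _))
    _ ≤ (∑ r ∈ range (n + 1), (B r).ncard) * 2 ^ n :=
        Nat.mul_le_mul_right _ (Finset.set_ncard_biUnion_le _ _)
    _ = ∑ r ∈ range (n + 1), (B r).ncard * 2 ^ n := sum_mul _ _ _
    _ ≤ (range (n + 1)).card • ((n ^ 2 + 1) * (matroidsOn n).ncard) :=
        sum_le_card_nsmul _ _ _ fun r _ => hBr r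
    _ = _ := by rw [card_range, smul_eq_mul]

end MatroidGirth

theorem theorem4p10 (c : ℝ) (hc : c < 1 / 2) :
    AlmostAllMatroids fun n M =>
      ((c * Real.logb 2 (n : ℝ) : ℝ) : EReal) ≤ ((M.girth : ENNReal) : EReal) := by
  unfold AlmostAllMatroids
  -- The exceptional proportion is at most (n + 1)(n² + 1)/2^n: the n + 1 ranks, times the factor
  -- from loops.
  have hlim : Tendsto (fun n : ℕ => 1 - 8 * ((n : ℝ) ^ 3 / 2 ^ n)) atTop (𝓝 1) := by
    have h := tendsto_pow_const_div_const_pow_of_one_lt 3 (r := (2 : ℝ)) (by norm_num)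
    simpa using (h.const_mul 8).const_sub 1
  refine tendsto_of_tendsto_of_tendsto_of_le_of_le' hlim tendsto_const_nhds ?_ ?_
  · filter_upwards [MatroidGirth.eventually_short_le hc, eventually_ge_atTop 1] with n h h1
    have hn : (1 : ℝ) ≤ n := by exact_mod_cast h1
    have hpos : (0 : ℝ) < (matroidsOn n).ncard := by
      exact_mod_cast (Set.ncard_pos (matroidsOn_finite n)).2 (matroidsOn_nonempty n)
    have hsplit := Set.ncard_inter_add_ncard_sdiff_eq_ncard (matroidsOn n)
      {M | ((c * Real.logb 2 (n : ℝ) : ℝ) : EReal) ≤ ((M.girth : ENNReal) : EReal)}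
      (matroidsOn_finite n)
    have hR : ((matroidsOn n ∩
        {M | ((c * Real.logb 2 (n : ℝ) : ℝ) : EReal) ≤ ((M.girth : ENNReal) : EReal)}).ncard : ℝ) +
        (matroidsOn n \
        {M | ((c * Real.logb 2 (n : ℝ) : ℝ) : EReal) ≤ ((M.girth : ENNReal) : EReal)}).ncard =
        (matroidsOn n).ncard := by exact_mod_cast hsplit
    have hb : ((matroidsOn n \
        {M | ((c * Real.logb 2 (n : ℝ) : ℝ) : EReal) ≤ ((M.girth : ENNReal) : EReal)}).ncard : ℝ) *
        2 ^ n ≤ (n + 1) * ((n ^ 2 + 1) * (matroidsOn n).ncard) := by exact_mod_cast h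
    rw [le_div_iff₀ hpos]
    have h2 : (0 : ℝ) < 2 ^ n := by positivity
    have hb' : ((matroidsOn n \
        {M | ((c * Real.logb 2 (n : ℝ) : ℝ) : EReal) ≤ ((M.girth : ENNReal) : EReal)}).ncard : ℝ) ≤
        8 * ((n : ℝ) ^ 3 / 2 ^ n) * (matroidsOn n).ncard := by
      rw [← mul_div_assoc, div_mul_eq_mul_div, le_div_iff₀ h2]
      refine hb.trans ?_
      have hpoly : ((n : ℝ) + 1) * (n ^ 2 + 1) ≤ 8 * n ^ 3 := by
        have h3 : (n : ℝ) + 1 ≤ 2 * n := by linarith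
        have h4 : (n : ℝ) ^ 2 + 1 ≤ 2 * n ^ 2 := by nlinarith
        calc ((n : ℝ) + 1) * (n ^ 2 + 1) ≤ (2 * n) * (2 * n ^ 2) := by gcongr
          _ = 4 * (n : ℝ) ^ 3 := by ring
          _ ≤ 8 * (n : ℝ) ^ 3 := by
            have : (0 : ℝ) ≤ (n : ℝ) ^ 3 := by positivity
            linarith
      calc ((n : ℝ) + 1) * (((n : ℝ) ^ 2 + 1) * ((matroidsOn n).ncard : ℝ))
          = (((n : ℝ) + 1) * ((n : ℝ) ^ 2 + 1)) * ((matroidsOn n).ncard : ℝ) := by ring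
        _ ≤ 8 * (n : ℝ) ^ 3 * ((matroidsOn n).ncard : ℝ) := by gcongr
    have hset : ({M | M ∈ matroidsOn n ∧
        ((c * Real.logb 2 (n : ℝ) : ℝ) : EReal) ≤ ((M.girth : ENNReal) : EReal)} :
        Set (Matroid (Fin n))) = matroidsOn n ∩
        {M | ((c * Real.logb 2 (n : ℝ) : ℝ) : EReal) ≤ ((M.girth : ENNReal) : EReal)} := rfl
    rw [hset]
    linarith
  · filter_upwards with n
    refine div_le_one_of_le₀ ?_ (by positivity)
    exact_mod_cast Set.ncard_le_ncard (Set.sep_subset _ _) (matroidsOn_finite n)
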